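/- Let $d\in\{-2,-7\}$ and let $R$ be the ring of integers of $\mathbb{Q}(\sqrt d)\subset\mathbb{C}$. For $m\ge 1$ put $\mathcal{L}_m=\{x\in R: x\overline{x}=m\}$, and let $\mathcal{L}=\{0\}\cup\mathcal{L}_1\cup\mathcal{L}_2\cup\mathcal{L}_3\cup\mathcal{L}_4$ and $\mathcal{L}'=\{0\}\cup\mathcal{L}_1\cup\mathcal{L}_2$. An $n$-vertex $\mathcal{L}$-graph (respectively $\mathcal{L}'$-graph) is an $n\times n$ Hermitian matrix $A$ with all entries in $\mathcal{L}$ (respectively $\mathcal{L}'$): $A_{ii}$ is the charge of vertex $i$, and a nonzero $A_{ij}$ with $i\ne j$ is the label of an edge from $i$ to $j$, of weight $A_{ij}\overline{A_{ij}}$. It is connected if the graph on the vertices in which $i\neq j$ are adjacent when $A_{ij}\neq0$ is connected. Subgraphs are induced subgraphs (principal submatrices). Two such graphs $A,B$ are equivalent if $A$ is obtained by conjugating one of $B,-B,\overline B,-\overline B$ by a signed permutation matrix. Let $\omega=\sqrt{-2}$ if $d=-2$ and $\omega=\tfrac12+\tfrac{\sqrt{-7}}2$ if $d=-7$. The ladder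 with $m$ columns has vertices $a_1,\dots,a_m$ (top row) and $b_1,\dots,b_m$ (bottom row), all of charge $0$; for $1\le i<m$ the edges $a_ia_{i+1}$ and $a_ib_{i+1}$ have label $1$, the edges $b_ia_{i+1}$ and $b_ib_{i+1}$ have label $-1$, and there are no other edges. Define the following graphs. - $T_{2k}$ ($k\ge3$): the ladder with $k$ columns together with the edges $a_ka_1$, $a_kb_1$ of label $1$ and $b_ka_1$, $b_kb_1$ of label $-1$. - $C_{2k}^{++}$ and $C_{2k}^{+-}$ ($k\ge2$), jointly written $C^{+\pm}_{2k}$: the ladder with $k$ columns, in which $a_1,b_1$ get charge $1$ and are joined by an edge of label $1$, and $a_k,b_k$ get charge $\varepsilon$ and are joined by an edge of label $-\varepsilon$, where $\varepsilon=1$ for $C_{2k}^{++}$ and $\varepsilon=-1$ for $C_{2k}^{+-}$. - $C_{2k}^{2+}$ ($k\ge1$): the ladder with $k$ columns, in which $a_1,b_1$ get charge $1$ and are joined by an edge of label $1$, together with one further uncharged vertex $r$ and edges from $a_k$ to $r$ with label $\omega$ and from $b_k$ to $r$ with label $-\omega$. - $T_{2k}^4$ ($k\ge2$): the ladder with $k-1$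 columns together with two further uncharged vertices $l,r$ and edges from $a_1$ to $l$ and from $b_1$ to $l$, both with label $\omega$, from $a_{k-1}$ to $r$ with label $\omega$, and from $b_{k-1}$ to $r$ with label $-\omega$. - ${T_{2k}^4}'$ ($k\ge2$, $d=-7$ only): the same as $T_{2k}^4$, except that the labels of the edges from $a_{k-1}$ and $b_{k-1}$ to $r$ are $\overline\omega$ and $-\overline\omega$. Let $G$ be connected with $n\ge 11$ vertices, and suppose that every proper connected subgraph of $G$ is equivalent to a subgraph of some $T_{2k}$, $C^{+\pm}_{2k}$, $C^{2+}_{2k}$, $T^4_{2k}$ or ${T^4_{2k}}'$. 1. If $G$ is an $\mathcal{L}'$-graph, then $G$ itself is equivalent to a subgraph of some $T_{2k}$, $C^{+\pm}_{2k}$, $C^{2+}_{2k}$, $T^4_{2k}$ or ${T^4_{2k}}'$. 2. If $G$ is an $\mathcal{L}$-graph that contains an edge of weight $2$, then $G$ is equivalent to a subgraph of some $T_{2k}^4$, ${T_{2k}^4}'$ or $C_{2k}^{2+}$. -/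

import Mathlib

noncomputable section

/-- The complex number `√d` for a negative integer `d`, namely `i√|d|`. -/
def sqrtNeg (d : ℤ) : ℂ := Complex.I * (Real.sqrt (-(d : ℝ)) : ℂ)

/-- The ring of integers of `ℚ(√d)`, `d < 0`, as a set of complex numbers. -/
def ringOfInt (d : ℤ) : Set ℂ :=
  {x | x ∈ IntermediateField.adjoin ℚ ({sqrtNeg d} : Set ℂ) ∧ IsIntegral ℤ x}

/-- The set of elements of norm `m` of the ring of integers of `ℚ(√d)`. -/
def normSet (d : ℤ) (m : ℕ) : Set ℂ :=
  {x | x ∈ ringOfInt d ∧ x * (starRingEnd ℂ) x = (m : ℂ)}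

/-- The label set `𝓛 = {0} ∪ 𝓛₁ ∪ 𝓛₂ ∪ 𝓛₃ ∪ 𝓛₄`. -/
def labelSet (d : ℤ) : Set ℂ :=
  {0} ∪ normSet d 1 ∪ normSet d 2 ∪ normSet d 3 ∪ normSet d 4

/-- The label set `𝓛' = {0} ∪ 𝓛₁ ∪ 𝓛₂`. -/
def labelSet' (d : ℤ) : Set ℂ := {0} ∪ normSet d 1 ∪ normSet d 2

/-- A graph with labels in a set `S ⊆ ℂ` is identified with the Hermitian matrix, with entries
in `S`, of its vertex weights (on the diagonal) and edge labels (off the diagonal). -/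
def IsLabelledGraph {V : Type*} (S : Set ℂ) (A : Matrix V V ℂ) : Prop :=
  A.IsHermitian ∧ ∀ i j, A i j ∈ S

/-- The simple graph joining two distinct vertices whenever the edge label is nonzero. -/
def underlying {V : Type*} (A : Matrix V V ℂ) : SimpleGraph V :=
  SimpleGraph.fromRel fun i j => A i j ≠ 0

/-- The subgraph induced on a set `S` of vertices. -/
def inducedSub {V : Type*} (A : Matrix V V ℂ) (S : Set V) : Matrix S S ℂ :=
  A.submatrix Subtype.val Subtype.val

/-- Strong equivalence: conjugation by a signed permutation matrix, that is a relabelling of the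
vertices followed by switching at some vertices. -/
def StronglyEquiv {V W : Type*} (A : Matrix V V ℂ) (B : Matrix W W ℂ) : Prop :=
  ∃ (e : V ≃ W) (s : V → ℤˣ), ∀ i j,
    A i j = ((s i : ℤ) : ℂ) * B (e i) (e j) * ((s j : ℤ) : ℂ)

/-- Equivalence: `A` is strongly equivalent to one of `B`, `-B`, `conj B`, `-conj B`. -/
def GraphEquiv {V W : Type*} (A : Matrix V V ℂ) (B : Matrix W W ℂ) : Prop :=
  StronglyEquiv A B ∨ StronglyEquiv A (-B) ∨
    StronglyEquiv A (B.map (starRingEnd ℂ)) ∨ StronglyEquiv A (-B.map (starRingEnd ℂ))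

/-- `A` is equivalent to an (induced) subgraph of `B`. -/
def EquivToSubgraph {V W : Type*} (A : Matrix V V ℂ) (B : Matrix W W ℂ) : Prop :=
  ∃ S : Set W, GraphEquiv A (inducedSub B S)

/-- The label `ω` of norm `2`: `√-2` for `d = -2` and `1/2 + √-7/2` for `d = -7`. -/
def omegaLabel (d : ℤ) : ℂ := if d = -7 then 1 / 2 + sqrtNeg d / 2 else sqrtNeg d

/-- The vertices of a ladder with `m` columns: a column index and a row, `0` for the top row and
`1` for the bottom row. -/
abbrev LadderVertex (m : ℕ) : Type := Fin m × Fin 2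

/-- `1` on the top row, `-1` on the bottom row. -/
def rowSign (r : Fin 2) : ℂ := if r = 0 then 1 else -1

/-- Edges of the ladder: each vertex of a column is joined to both vertices of the next column,
with label `1` if it is in the top row and `-1` if it is in the bottom row. -/
def ladderEdge {m : ℕ} (p q : LadderVertex m) : ℂ :=
  if (q.1 : ℕ) = (p.1 : ℕ) + 1 then rowSign p.2
  else if (p.1 : ℕ) = (q.1 : ℕ) + 1 then rowSign q.2
  else 0

/-- The toroidal graph `T_{2k}` (used for `k ≥ 3`): the ladder on `k` columns, closed up
cyclically. -/
def graphT (k : ℕ) : Matrix (LadderVertex k) (LadderVertex k) ℂ :=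
  Matrix.of fun p q =>
    if (q.1 : ℕ) = ((p.1 : ℕ) + 1) % k then rowSign p.2
    else if (p.1 : ℕ) = ((q.1 : ℕ) + 1) % k then rowSign q.2
    else 0

/-- The graphs `C_{2k}^{++}` (`ε = 1`) and `C_{2k}^{+-}` (`ε = -1`), used for `k ≥ 2`: the ladder
on `k` columns, with two joined vertices of charge `1` in the first column (edge label `1`), and
two joined vertices of charge `ε` in the last column (edge label `-ε`). -/
def graphC (ε : ℤˣ) (k : ℕ) : Matrix (LadderVertex k) (LadderVertex k) ℂ :=
  Matrix.of fun p q =>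
    if p.1 = q.1 then
      if (p.1 : ℕ) = 0 then 1
      else if (p.1 : ℕ) + 1 = k then
        if p.2 = q.2 then ((ε : ℤ) : ℂ) else -((ε : ℤ) : ℂ)
      else 0
    else ladderEdge p q

/-- The graph `C_{2k}^{2+}` (used for `k ≥ 1`): the ladder on `k` columns, with two joined vertices
of charge `1` in the first column, and one further vertex, joined to the last column by edges
with labels `ω` (from the top row) and `-ω` (from the bottom row). -/
def graphC2 (d : ℤ) (k : ℕ) : Matrix (LadderVertex k ⊕ Unit) (LadderVertex k ⊕ Unit) ℂ :=
  Matrix.of fun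
    | .inl p, .inl q =>
        if p.1 = q.1 then (if (p.1 : ℕ) = 0 then 1 else 0) else ladderEdge p q
    | .inl p, .inr _ =>
        if (p.1 : ℕ) + 1 = k then rowSign p.2 * omegaLabel d else 0
    | .inr _, .inl q =>
        if (q.1 : ℕ) + 1 = k then (starRingEnd ℂ) (rowSign q.2 * omegaLabel d) else 0
    | .inr _, .inr _ => 0

/-- The label on an edge from a ladder vertex to one of two further vertices: the first one is
joined to the first column with labels `ω`, `ω`, and the second one to the last column with
labels `η` (top row) and `-η` (bottom row). -/
def endLabel (ω η : ℂ) {m : ℕ} (p : LadderVertex m) (t : Fin 2) : ℂ :=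
  if t = 0 then (if (p.1 : ℕ) = 0 then ω else 0)
  else (if (p.1 : ℕ) + 1 = m then rowSign p.2 * η else 0)

/-- The uncharged ladder on `k - 1` columns with two further vertices attached to its ends; it
has `2k` vertices. It is `T_{2k}^4` for `η = ω` and `T_{2k}^4'` for `η = conj ω`. -/
def graphT4Aux (ω η : ℂ) (k : ℕ) :
    Matrix (LadderVertex (k - 1) ⊕ Fin 2) (LadderVertex (k - 1) ⊕ Fin 2) ℂ :=
  Matrix.of fun
    | .inl p, .inl q => ladderEdge p q
    | .inl p, .inr t => endLabel ω η p t
    | .inr t, .inl q => (starRingEnd ℂ) (endLabel ω η q t)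
    | .inr _, .inr _ => 0

/-- The graph `T_{2k}^4`, used for `k ≥ 2`. -/
def graphT4 (d : ℤ) (k : ℕ) :
    Matrix (LadderVertex (k - 1) ⊕ Fin 2) (LadderVertex (k - 1) ⊕ Fin 2) ℂ :=
  graphT4Aux (omegaLabel d) (omegaLabel d) k

/-- The graph `T_{2k}^4'`, used for `k ≥ 2` and `d = -7`. -/
def graphT4' (d : ℤ) (k : ℕ) :
    Matrix (LadderVertex (k - 1) ⊕ Fin 2) (LadderVertex (k - 1) ⊕ Fin 2) ℂ :=
  graphT4Aux (omegaLabel d) ((starRingEnd ℂ) (omegaLabel d)) k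

/-- Equivalent to a subgraph of some `T_{2k}^4`, `T_{2k}^4'` or `C_{2k}^{2+}`. -/
def InWeightTwoFamilies (d : ℤ) {V : Type*} (A : Matrix V V ℂ) : Prop :=
  (∃ k, 2 ≤ k ∧ EquivToSubgraph A (graphT4 d k)) ∨
  (d = -7 ∧ ∃ k, 2 ≤ k ∧ EquivToSubgraph A (graphT4' d k)) ∨
  (∃ k, 1 ≤ k ∧ EquivToSubgraph A (graphC2 d k))

/-- Equivalent to a subgraph of some `T_{2k}`, `C_{2k}^{++}`, `C_{2k}^{+-}`, `C_{2k}^{2+}`,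
`T_{2k}^4` or `T_{2k}^4'`. -/
def InFamilies (d : ℤ) {V : Type*} (A : Matrix V V ℂ) : Prop :=
  (∃ k, 3 ≤ k ∧ EquivToSubgraph A (graphT k)) ∨
  (∃ k, 2 ≤ k ∧ ∃ ε : ℤˣ, EquivToSubgraph A (graphC ε k)) ∨
  InWeightTwoFamilies d A

/-- Every proper connected (induced) subgraph lies in the families. -/
def ProperSubgraphsInFamilies (d : ℤ) {V : Type*} (A : Matrix V V ℂ) : Prop :=
  ∀ S : Set V, S ≠ Set.univ → (underlying (inducedSub A S)).Connected →
    InFamilies d (inducedSub A S)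

end

/-!
The families are subgraphs of one kind of object, the universal ladder `ladderModel`: vertices are
arranged in columns of at most two, the columns lie on a line (indexed by `ℤ`) or on a cycle
(indexed by `ZMod m`), and vertices of neighbouring columns are always joined. A subgraph on at
least nine vertices carries a *column structure* `ColStr`, which records in an intrinsic way what
the ladder imposes on the labels: signs of quadrilaterals through two vertices of one column, and
the fact that charges and edges of weight other than `1` occur only at an end of a line
(`colStr_of_ladderModel`, `hasColStr_of_inFamilies`). Nine vertices exclude the toroidal graphs
with three or four columns, so that every cycle of columns has at least five of them.

In a connected graph on at least nine vertices with a column structure, two vertices are in the same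
column if and only if they are twins, that is, have the same neighbours apart from each other
(`ColStr.eq_of_twinOn`). Consequently the column structures of different proper connected subgraphs
of `G` are compatible: being twins in a proper connected subgraph on ten or more vertices is the
same as being twins in `G` (`LocallyColumnar.twin_of_twinOn`). As each condition in a column
structure concerns at most four vertices, which lie in a connected subgraph on ten vertices, a
column map for the whole of `G` has a column structure as soon as its columns are the classes of
twins and its neighbouring columns are the adjacent classes (`LocallyColumnar.colStr_univ`).

To find such a map, remove a vertex `v` that leaves `G` connected, and take the columns of the rest.
If `v` has a twin it joins the column of its twin. Otherwise it can be adjacent only to columns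
that lack a neighbour on one side, because no vertex has neighbours in three classes of twins
besides its own; so `v` prolongs a line of columns, or closes it up to a cycle
(`LocallyColumnar.exists_colStr`).

Finally, two graphs with the same columns whose labels agree up to sign differ by switching,
except for the sign of the cycle in the cyclic case (`exists_switch`), and that sign changes when
the two vertices of a column of the toroidal graph are exchanged. In the linear case the charges and
weights at the two ends determine the family (`LineStr.inFamilies`). So `G` is in the families, and
an edge of weight two excludes those families whose labels are `0` and `±1` only.
-/

/-! ### Connected sets of vertices -/

section Connected

variable {V : Type*} {A : Matrix V V ℂ}

theorem ne_zero_symm (hA : A.IsHermitian) {x y : V} (h : A x y ≠ 0) : A y x ≠ 0 := by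
  intro h0
  apply h
  rw [← hA.apply x y, h0, star_zero]

/-- A finite set `S` of vertices induces a connected subgraph, phrased by closed sets: `S` is
nonempty and a nonempty part of `S` without edges to the rest of `S` is all of `S`. -/
def ConnOn (A : Matrix V V ℂ) (S : Finset V) : Prop :=
  S.Nonempty ∧ ∀ T ⊆ S, T.Nonempty → (∀ x ∈ T, ∀ y ∈ S, A x y ≠ 0 → y ∈ T) → S ⊆ T

theorem connOn_singleton (x : V) : ConnOn A {x} := by
  refine ⟨Finset.singleton_nonempty x, fun T hT hne _ => ?_⟩
  rw [hne.subset_singleton_iff.1 hT]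

theorem ConnOn.insert_vertex [DecidableEq V] (hA : A.IsHermitian) {S : Finset V}
    (hS : ConnOn A S) {v s : V}
    (hs : s ∈ S) (h : A v s ≠ 0) : ConnOn A (insert v S) := by
  refine ⟨Finset.insert_nonempty _ _, fun T hT hne hcl => ?_⟩
  have key : (T ∩ S).Nonempty → insert v S ⊆ T := by
    intro h1
    have h2 : S ⊆ T ∩ S := hS.2 _ Finset.inter_subset_right h1 fun x hx y hy hxy =>
      Finset.mem_inter.2
        ⟨hcl x (Finset.mem_inter.1 hx).1 y (Finset.mem_insert_of_mem hy) hxy, hy⟩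
    have h3 : S ⊆ T := fun x hx => (Finset.mem_inter.1 (h2 hx)).1
    exact Finset.insert_subset
      (hcl s (h3 hs) v (Finset.mem_insert_self _ _) (ne_zero_symm hA h)) h3
  obtain ⟨x, hx⟩ := hne
  rcases Finset.mem_insert.1 (hT hx) with rfl | hxS
  · exact key ⟨s, Finset.mem_inter.2 ⟨hcl x hx s (Finset.mem_insert_of_mem hs) h, hs⟩⟩
  · exact key ⟨x, Finset.mem_inter.2 ⟨hx, hxS⟩⟩

/-- A connected set grows, one vertex at a time, inside a larger connected set. -/
theorem ConnOn.exists_between [DecidableEq V] (hA : A.IsHermitian) {S Z : Finset V}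
    (hS : ConnOn A S)
    (hZ : ConnOn A Z) (hSZ : S ⊆ Z) {k : ℕ} (hk : S.card ≤ k) (hkZ : k ≤ Z.card) :
    ∃ T, S ⊆ T ∧ T ⊆ Z ∧ ConnOn A T ∧ T.card = k := by
  induction k, hk using Nat.le_induction with
  | base => exact ⟨S, subset_rfl, hSZ, hS, rfl⟩
  | succ k _ ih =>
    obtain ⟨T, hST, hTZ, hT, hcard⟩ := ih (by omega)
    have : ∃ x ∈ T, ∃ y ∈ Z, A x y ≠ 0 ∧ y ∉ T := by
      by_contra! hcon
      have := Finset.card_le_card (hZ.2 T hTZ hT.1 hcon)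
      omega
    obtain ⟨x, hx, y, hy, hxy, hyT⟩ := this
    exact ⟨insert y T, hST.trans (Finset.subset_insert _ _), Finset.insert_subset hy hTZ,
      hT.insert_vertex hA hx (ne_zero_symm hA hxy), by rw [Finset.card_insert_of_notMem hyT, hcard]⟩

theorem underlying_adj (hA : A.IsHermitian) {x y : V} :
    (underlying A).Adj x y ↔ x ≠ y ∧ A x y ≠ 0 := by
  simp only [underlying, SimpleGraph.fromRel_adj]
  exact and_congr_right fun _ => ⟨fun h => h.elim id (ne_zero_symm hA), Or.inl⟩

theorem inducedSub_isHermitian (hA : A.IsHermitian) (S : Set V) :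
    (inducedSub A S).IsHermitian :=
  hA.submatrix _

theorem ConnOn.connected (hA : A.IsHermitian) {S : Finset V} (hS : ConnOn A S) :
    (underlying (inducedSub A (S : Set V))).Connected := by
  obtain ⟨x, hx⟩ := hS.1
  rw [SimpleGraph.connected_iff_exists_forall_reachable]
  refine ⟨⟨x, hx⟩, ?_⟩
  classical
  set T : Finset V := S.filter fun y =>
    ∃ h : y ∈ S, (underlying (inducedSub A (S : Set V))).Reachable ⟨x, hx⟩ ⟨y, h⟩ with hT
  have hsub : S ⊆ T := by
    refine hS.2 T (Finset.filter_subset _ _)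
      ⟨x, Finset.mem_filter.2 ⟨hx, hx, SimpleGraph.Reachable.refl _⟩⟩ ?_
    intro a ha b hb hab
    obtain ⟨-, ha', hr⟩ := Finset.mem_filter.1 ha
    refine Finset.mem_filter.2 ⟨hb, hb, ?_⟩
    by_cases hne : a = b
    · subst hne; exact hr
    · refine hr.trans (SimpleGraph.Adj.reachable ?_)
      rw [underlying_adj (inducedSub_isHermitian hA _)]
      exact ⟨fun h => hne (congrArg Subtype.val h), hab⟩
  rintro ⟨y, hy⟩
  obtain ⟨-, _, hr⟩ := Finset.mem_filter.1 (hsub hy)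
  exact hr

theorem connOn_univ [Fintype V] (hA : A.IsHermitian) (h : (underlying A).Connected) :
    ConnOn A Finset.univ := by
  obtain ⟨x⟩ := h.nonempty
  refine ⟨⟨x, Finset.mem_univ x⟩, ?_⟩
  rintro T - ⟨a, ha⟩ hcl y -
  obtain ⟨w⟩ := h.preconnected a y
  induction w with
  | nil => exact ha
  | cons hadj _ ih => exact ih (hcl _ ha _ (Finset.mem_univ _) ((underlying_adj hA).1 hadj).2)

end Connected

/-! ### Column structures -/

/-- Two columns are next to each other. Columns are elements of a ring, which will be `ℤ` for
graphs that look like a path and `ZMod m` for graphs that look like a cycle. -/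
def Nb {C : Type*} [CommRing C] (a b : C) : Prop := b = a + 1 ∨ a = b + 1

/-- There are at least three columns: `1` and `2` are nonzero, so the column `a` and its neighbours
`a + 1` and `a - 1` are different. -/
class FarCols (C : Type*) [CommRing C] : Prop where
  one : (1 : C) ≠ 0
  two : (2 : C) ≠ 0

/-- The possible edge labels: the units `±1` and the elements `±ω`, `±conj ω`. -/
def edgeLabels (ω : ℂ) : Set ℂ :=
  {1, -1, ω, -ω, (starRingEnd ℂ) ω, -(starRingEnd ℂ) ω}

/-- A column structure on the set `S` of vertices of the graph `A`. Every column has at most two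
vertices (`fiber`), edges join vertices of the same column or of neighbouring columns (`near`), and
all pairs of vertices from neighbouring columns are joined (`label`). The sign of a quadrilateral
through two vertices of one column depends only on whether its other two vertices lie on the same
side (`same`, `opp`). A charge, or an edge of weight other than `1`, occurs only at an end
(`charge_end`, `heavy`). All conditions depend on the column map only through the relations of
being in equal or in neighbouring columns. -/
structure ColStr {V C : Type*} [CommRing C] (ω : ℂ) (A : Matrix V V ℂ) (S : Finset V)
    (col : V → C) : Prop where
  near : ∀ x ∈ S, ∀ y ∈ S, A x y ≠ 0 → col x = col y ∨ Nb (col x) (col y)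
  label : ∀ x ∈ S, ∀ y ∈ S, Nb (col x) (col y) → A x y ∈ edgeLabels ω
  fiber : ∀ x ∈ S, ∀ y ∈ S, ∀ z ∈ S, col x = col y → col x = col z → x = y ∨ x = z ∨ y = z
  charge : ∀ x ∈ S, A x x = 0 ∨ A x x = 1 ∨ A x x = -1
  same : ∀ x ∈ S, ∀ y ∈ S, ∀ p ∈ S, ∀ q ∈ S, col x = col y → col p = col q →
    Nb (col x) (col p) → A x p * A p y * (A y q * A q x) = A x p * A p x * (A x q * A q x)
  opp : ∀ x ∈ S, ∀ y ∈ S, ∀ p ∈ S, ∀ q ∈ S, x ≠ y → col x = col y → col p ≠ col q →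
    Nb (col x) (col p) → Nb (col x) (col q) →
    A x p * A p y * (A y q * A q x) = -(A x p * A p x * (A x q * A q x))
  ratio : ∀ x ∈ S, ∀ y ∈ S, ∀ p ∈ S, col x = col y → Nb (col x) (col p) →
    A x p = A y p ∨ A x p = -A y p
  twin : ∀ x ∈ S, ∀ y ∈ S, ∀ p ∈ S, x ≠ y → col x = col y → Nb (col x) (col p) →
    A x y * A y p * A p x = -(A x x * (A x p * A p x))
  charge_end : ∀ x ∈ S, ∀ p ∈ S, ∀ q ∈ S, A x x ≠ 0 → Nb (col x) (col p) →
    Nb (col x) (col q) → col p = col q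
  heavy : ∀ x ∈ S, ∀ y ∈ S, Nb (col x) (col y) → A x y * A y x ≠ 1 →
    (A x x = 0 ∧ ∀ z ∈ S, (col z = col x → z = x) ∧ (Nb (col x) (col z) → col z = col y)) ∨
    (A y y = 0 ∧ ∀ z ∈ S, (col z = col y → z = y) ∧ (Nb (col y) (col z) → col z = col x))

section Nb

variable {C : Type*} [CommRing C] {a b c d : C}

theorem Nb.symm (h : Nb a b) : Nb b a := Or.symm h

theorem Nb.ne [FarCols C] (h : Nb a b) : a ≠ b := by
  rintro rfl
  have := FarCols.one (C := C)
  rcases h with h | h <;> exact this (by linear_combination -h)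

/-- A column has at most two neighbouring columns. -/
theorem Nb.two_of_three (hb : Nb a b) (hc : Nb a c) (hd : Nb a d) : b = c ∨ b = d ∨ c = d := by
  unfold Nb at hb hc hd
  grind

end Nb

section ColStr

variable {V C C' : Type*} [CommRing C] [CommRing C'] {ω : ℂ} {A : Matrix V V ℂ}
  {S T : Finset V} {col : V → C} {col' : V → C'}

theorem edgeLabels_ne_zero (hω : ω ≠ 0) {z : ℂ} (hz : z ∈ edgeLabels ω) : z ≠ 0 := by
  have : (starRingEnd ℂ) ω ≠ 0 := by simpa using hω
  simp only [edgeLabels, Set.mem_insert_iff, Set.mem_singleton_iff] at hz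
  rcases hz with rfl | rfl | rfl | rfl | rfl | rfl <;> simp [hω]

theorem ColStr.ne_zero (h : ColStr ω A S col) (hω : ω ≠ 0) {x y : V} (hx : x ∈ S) (hy : y ∈ S)
    (hxy : Nb (col x) (col y)) : A x y ≠ 0 :=
  edgeLabels_ne_zero hω (h.label x hx y hy hxy)

/-- A column structure may be transported along any relabelling of the columns that preserves
equality and neighbourhood on the columns in use. -/
theorem ColStr.of_iff (h : ColStr ω A S col) (hTS : T ⊆ S)
    (heq : ∀ x ∈ T, ∀ y ∈ T, col' x = col' y ↔ col x = col y)
    (hnb : ∀ x ∈ T, ∀ y ∈ T, Nb (col' x) (col' y) ↔ Nb (col x) (col y)) :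
    ColStr ω A T col' where
  near x hx y hy := by
    rw [heq x hx y hy, hnb x hx y hy]; exact h.near x (hTS hx) y (hTS hy)
  label x hx y hy := by
    rw [hnb x hx y hy]; exact h.label x (hTS hx) y (hTS hy)
  fiber x hx y hy z hz := by
    rw [heq x hx y hy, heq x hx z hz]; exact h.fiber x (hTS hx) y (hTS hy) z (hTS hz)
  charge x hx := h.charge x (hTS hx)
  same x hx y hy p hp q hq := by
    rw [heq x hx y hy, heq p hp q hq, hnb x hx p hp]
    exact h.same x (hTS hx) y (hTS hy) p (hTS hp) q (hTS hq)
  opp x hx y hy p hp q hq := by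
    rw [heq x hx y hy, ne_eq (col' p), heq p hp q hq, hnb x hx p hp, hnb x hx q hq]
    exact h.opp x (hTS hx) y (hTS hy) p (hTS hp) q (hTS hq)
  ratio x hx y hy p hp := by
    rw [heq x hx y hy, hnb x hx p hp]; exact h.ratio x (hTS hx) y (hTS hy) p (hTS hp)
  twin x hx y hy p hp := by
    rw [heq x hx y hy, hnb x hx p hp]; exact h.twin x (hTS hx) y (hTS hy) p (hTS hp)
  charge_end x hx p hp q hq := by
    rw [heq p hp q hq, hnb x hx p hp, hnb x hx q hq]
    exact h.charge_end x (hTS hx) p (hTS hp) q (hTS hq)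
  heavy x hx y hy hxy hne := by
    rw [hnb x hx y hy] at hxy
    refine (h.heavy x (hTS hx) y (hTS hy) hxy hne).imp (And.imp_right fun H z hz => ?_)
      (And.imp_right fun H z hz => ?_)
    · rw [heq z hz x hx, heq z hz y hy, hnb x hx z hz]; exact H z (hTS hz)
    · rw [heq z hz y hy, heq z hz x hx, hnb y hy z hz]; exact H z (hTS hz)

theorem ColStr.mono (h : ColStr ω A S col) (hTS : T ⊆ S) : ColStr ω A T col :=
  h.of_iff hTS (fun _ _ _ _ => Iff.rfl) fun _ _ _ _ => Iff.rfl

theorem ColStr.card_le (h : ColStr ω A S col) (F : Finset C)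
    (hF : ∀ x ∈ S, col x ∈ F) : S.card ≤ 2 * F.card := by
  classical
  refine Finset.card_le_mul_card_image_of_maps_to hF 2 fun c _ => ?_
  by_contra! hlt
  obtain ⟨x, y, z, hx, hy, hz, hxy, hxz, hyz⟩ := Finset.two_lt_card_iff.1 hlt
  rw [Finset.mem_filter] at hx hy hz
  rcases h.fiber x hx.1 y hy.1 z hz.1 (hx.2.trans hy.2.symm) (hx.2.trans hz.2.symm) with h | h | h
  exacts [hxy h, hxz h, hyz h]

/-- The vertices `x` and `y` have the same neighbours in `S`, apart from `x` and `y`. -/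
def TwinOn (A : Matrix V V ℂ) (S : Finset V) (x y : V) : Prop :=
  ∀ z ∈ S, z ≠ x → z ≠ y → (A x z ≠ 0 ↔ A y z ≠ 0)

theorem TwinOn.symm {x y : V} (h : TwinOn A S x y) : TwinOn A S y x :=
  fun z hz hy hx => (h z hz hx hy).symm

theorem ColStr.twinOn (h : ColStr ω A S col) (hω : ω ≠ 0) {x y : V} (hx : x ∈ S) (hy : y ∈ S)
    (hne : x ≠ y) (hxy : col x = col y) : TwinOn A S x y := by
  have key : ∀ x ∈ S, ∀ y ∈ S, x ≠ y → col x = col y → ∀ z ∈ S, z ≠ x → z ≠ y →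
      A x z ≠ 0 → A y z ≠ 0 := by
    intro x hx y hy hne hxy z hz hzx hzy h0
    rcases h.near x hx z hz h0 with h1 | h1
    · rcases h.fiber x hx y hy z hz hxy h1 with h2 | h2 | h2
      exacts [absurd h2 hne, absurd h2.symm hzx, absurd h2.symm hzy]
    · exact h.ne_zero hω hy hz (hxy ▸ h1)
  exact fun z hz hzx hzy =>
    ⟨key x hx y hy hne hxy z hz hzx hzy, key y hy x hx hne.symm hxy.symm z hz hzy hzx⟩

/-- In a connected graph with at least nine vertices the columns of a column structure are
determined by the graph: two vertices are in the same column if and only if they are twins. -/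
theorem ColStr.eq_of_twinOn [FarCols C] (h : ColStr ω A S col) (hω : ω ≠ 0)
    (hS : ConnOn A S) (hcard : 9 ≤ S.card) {x y : V} (hx : x ∈ S) (hy : y ∈ S)
    (ht : TwinOn A S x y) : col x = col y := by
  classical
  by_contra hne
  have key : ∀ x ∈ S, ∀ y ∈ S, TwinOn A S x y → ∀ z ∈ S, Nb (col x) (col z) →
      col z = col y ∨ Nb (col y) (col z) := by
    intro x hx y hy ht z hz hxz
    by_cases hzy : z = y
    · exact Or.inl (by rw [hzy])
    have hzx : z ≠ x := by rintro rfl; exact hxz.ne rfl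
    exact (h.near y hy z hz ((ht z hz hzx hzy).1 (h.ne_zero hω hx hz hxz))).imp_left Eq.symm
  -- If the columns of `x` and `y` differed, these two columns and the columns next to that of `x`
  -- would be closed under adjacency, which leaves room for eight vertices only.
  have hsub : S ⊆ S.filter fun z => col z = col x ∨ col z = col y ∨ Nb (col x) (col z) := by
    refine hS.2 _ (Finset.filter_subset _ _) ⟨x, by simp [hx]⟩ ?_
    intro z hz w hw hzw
    obtain ⟨hzS, hz⟩ := Finset.mem_filter.1 hz
    refine Finset.mem_filter.2 ⟨hw, ?_⟩
    have hnear := h.near z hzS w hw hzw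
    have hyw := key y hy x hx ht.symm w hw
    rcases hz with hz | hz | hz
    · rw [hz] at hnear
      rcases hnear with hnear | hnear
      exacts [Or.inl hnear.symm, Or.inr (Or.inr hnear)]
    · rw [hz] at hnear
      rcases hnear with hnear | hnear
      · exact Or.inr (Or.inl hnear.symm)
      · exact (hyw hnear).imp_right Or.inr
    · rcases hnear with hnear | hnear
      · exact Or.inr (Or.inr (hnear ▸ hz))
      · rcases key x hx y hy ht z hzS hz with h1 | h1
        · rw [h1] at hnear
          exact (hyw hnear).imp_right Or.inr
        · rcases Nb.two_of_three hz.symm h1.symm hnear with h2 | h2 | h2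
          exacts [absurd h2 hne, Or.inl h2.symm, Or.inr (Or.inl h2.symm)]
  have := h.card_le {col x, col y, col x + 1, col x - 1} fun z hz => by
    have := (Finset.mem_filter.1 (hsub hz)).2
    simp only [Finset.mem_insert, Finset.mem_singleton]
    rcases this with h1 | h1 | h1 | h1
    · exact Or.inl h1
    · exact Or.inr (Or.inl h1)
    · exact Or.inr (Or.inr (Or.inl h1))
    · exact Or.inr (Or.inr (Or.inr (by rw [h1]; ring)))
  have h4 : ({col x, col y, col x + 1, col x - 1} : Finset C).card ≤ 4 := Finset.card_le_four
  omega

end ColStr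

/-! ### From local to global column structures -/

/-- Some column structure exists on `S`, with columns arranged in a line or in a cycle. -/
def HasColStr {V : Type*} (ω : ℂ) (A : Matrix V V ℂ) (S : Finset V) : Prop :=
  (∃ col : V → ℤ, ColStr ω A S col) ∨
    ∃ m : ℕ, 5 ≤ m ∧ ∃ col : V → ZMod m, ColStr ω A S col

instance : FarCols ℤ := ⟨by norm_num, by norm_num⟩

theorem farCols_zmod {m : ℕ} (hm : 3 ≤ m) : FarCols (ZMod m) := by
  have key : ∀ j : ℕ, 0 < j → j < m → ((j : ℕ) : ZMod m) ≠ 0 := fun j h0 h1 h => by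
    have := Nat.le_of_dvd h0 ((ZMod.natCast_eq_zero_iff j m).1 h)
    omega
  exact ⟨by exact_mod_cast key 1 (by omega) (by omega),
    by exact_mod_cast key 2 (by omega) (by omega)⟩

theorem HasColStr.exists_ring {V : Type*} {ω : ℂ} {A : Matrix V V ℂ} {S : Finset V}
    (h : HasColStr ω A S) :
    ∃ (C : Type) (_ : CommRing C) (_ : FarCols C) (col : V → C), ColStr ω A S col := by
  rcases h with ⟨col, h⟩ | ⟨m, hm, col, h⟩
  · exact ⟨ℤ, inferInstance, inferInstance, col, h⟩
  · exact ⟨ZMod m, inferInstance, farCols_zmod (by omega), col, h⟩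

/-- A connected graph with at least eleven vertices whose proper connected subgraphs on ten or more
vertices all have column structures. -/
structure LocallyColumnar {V : Type*} [Fintype V] (ω : ℂ) (A : Matrix V V ℂ) : Prop where
  herm : A.IsHermitian
  ne_zero : ω ≠ 0
  conn : ConnOn A Finset.univ
  card : 11 ≤ Fintype.card V
  proper : ∀ S : Finset V, ConnOn A S → S ≠ Finset.univ → 10 ≤ S.card → HasColStr ω A S

section Local

variable {V : Type*} [DecidableEq V] {ω : ℂ} {A : Matrix V V ℂ}

theorem TwinOn.exists_common {S : Finset V} (hS : ConnOn A S) (hcard : 3 ≤ S.card)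
    {x y : V} (hx : x ∈ S) (hy : y ∈ S) (ht : TwinOn A S x y) :
    ∃ p ∈ S, p ≠ x ∧ p ≠ y ∧ A x p ≠ 0 ∧ A y p ≠ 0 := by
  by_contra! hcon
  have hsub : S ⊆ {x, y} := by
    refine hS.2 _ (by simp [Finset.insert_subset_iff, hx, hy]) ⟨x, by simp⟩ ?_
    intro z hz w hw hzw
    by_contra hw'
    simp only [Finset.mem_insert, Finset.mem_singleton, not_or] at hz hw'
    have h1 := hcon w hw hw'.1 hw'.2
    have h2 := ht w hw hw'.1 hw'.2
    rcases hz with rfl | rfl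
    · exact h2.1 hzw (h1 hzw)
    · exact hzw (h1 (h2.2 hzw))
  have := (Finset.card_le_card hsub).trans Finset.card_le_two
  omega

variable [Fintype V]

/-- Being twins in a proper connected subgraph on ten or more vertices is the same as being twins
in the whole graph. A vertex `t` that tells the twins `x` and `y` apart may replace some vertex of
the subgraph; nine vertices of it remain, and these determine the columns of `x` and `y`. -/
theorem LocallyColumnar.twin_of_twinOn (G : LocallyColumnar ω A) {Z : Finset V}
    (hZ : ConnOn A Z) (hcard : 10 ≤ Z.card) {x y : V} (hx : x ∈ Z)
    (hy : y ∈ Z) (hxy : x ≠ y) (ht : TwinOn A Z x y) : TwinOn A Finset.univ x y := by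
  by_contra hcon
  simp only [TwinOn, not_forall] at hcon
  obtain ⟨t, -, htx, hty, htne⟩ := hcon
  have htZ : t ∉ Z := fun h => htne (ht t h htx hty)
  obtain ⟨p, hp, hpx, hpy, hxp, hyp⟩ := ht.exists_common hZ (by omega) hx hy
  have hK : ConnOn A {y, x, p} :=
    (((connOn_singleton p).insert_vertex G.herm (Finset.mem_singleton_self p)
      hxp).insert_vertex G.herm (by simp) hyp)
  obtain ⟨W, hKW, hWZ, hW, hWcard⟩ := hK.exists_between G.herm hZ
    (by simp [Finset.insert_subset_iff, hx, hy, hp]) (k := 9)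
    (Finset.card_le_three.trans (by omega)) (by omega)
  have hxW : x ∈ W := hKW (by simp)
  have hyW : y ∈ W := hKW (by simp)
  have hadj : A t x ≠ 0 ∨ A t y ≠ 0 := by
    by_contra! h
    apply htne
    rw [← G.herm.apply x t, ← G.herm.apply y t, h.1, h.2]
  have htW : t ∉ W := fun h => htZ (hWZ h)
  have hW' : ConnOn A (insert t W) :=
    hadj.elim (fun h => hW.insert_vertex G.herm hxW h) fun h => hW.insert_vertex G.herm hyW h
  have hcard' : (insert t W).card = 10 := by rw [Finset.card_insert_of_notMem htW, hWcard]
  obtain ⟨C, _, _, col, hcol⟩ := (G.proper _ hW'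
    (fun h => by rw [h, Finset.card_univ] at hcard'; have := G.card; omega) hcard'.ge).exists_ring
  have heq := (hcol.mono (Finset.subset_insert t W)).eq_of_twinOn G.ne_zero hW hWcard.ge hxW hyW
    fun z hz => ht z (hWZ hz)
  exact htne (hcol.twinOn G.ne_zero (Finset.mem_insert_of_mem hxW) (Finset.mem_insert_of_mem hyW)
    hxy heq t (Finset.mem_insert_self _ _) htx hty)

theorem LocallyColumnar.col_eq_iff (G : LocallyColumnar ω A) {Z : Finset V} (hZ : ConnOn A Z)
    (hcard : 10 ≤ Z.card) {C : Type*} [CommRing C] [FarCols C]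
    {col : V → C} (hcol : ColStr ω A Z col) {x y : V} (hx : x ∈ Z) (hy : y ∈ Z) (hxy : x ≠ y) :
    col x = col y ↔ TwinOn A Finset.univ x y :=
  ⟨fun h => G.twin_of_twinOn hZ hcard hx hy hxy (hcol.twinOn G.ne_zero hx hy hxy h),
    fun h => hcol.eq_of_twinOn G.ne_zero hZ (by omega) hx hy fun z _ => h z (Finset.mem_univ z)⟩

theorem LocallyColumnar.exists_local (G : LocallyColumnar ω A) {K : Finset V} (hK : ConnOn A K)
    (hcard : K.card ≤ 10) :
    ∃ (C : Type) (_ : CommRing C) (_ : FarCols C) (col : V → C), ColStr ω A K col ∧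
      ∀ x ∈ K, ∀ y ∈ K, x ≠ y → (col x = col y ↔ TwinOn A Finset.univ x y) := by
  have := G.card
  obtain ⟨Z, hKZ, -, hZ, hZcard⟩ := hK.exists_between G.herm G.conn (Finset.subset_univ K)
    hcard (by rw [Finset.card_univ]; omega)
  obtain ⟨C, _, _, col, hcol⟩ := (G.proper Z hZ
    (fun h => by rw [h, Finset.card_univ] at hZcard; omega) hZcard.ge).exists_ring
  exact ⟨C, _, ‹_›, col, hcol.mono hKZ, fun x hx y hy =>
    G.col_eq_iff hZ hZcard.ge hcol (hKZ hx) (hKZ hy)⟩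

/-- Classes of twins have at most two members. -/
theorem LocallyColumnar.twin_unique (G : LocallyColumnar ω A) {x y z : V} (hxy : x ≠ y)
    (hxz : x ≠ z) (hyz : y ≠ z) (h1 : TwinOn A Finset.univ x y)
    (h2 : TwinOn A Finset.univ x z) : False := by
  obtain ⟨p, -, hpx, hpy, hxp, hyp⟩ := h1.exists_common G.conn
    (by rw [Finset.card_univ]; have := G.card; omega) (Finset.mem_univ x) (Finset.mem_univ y)
  have hKp : ConnOn A {y, x, p} := ((connOn_singleton p).insert_vertex G.herm
    (Finset.mem_singleton_self p) hxp).insert_vertex G.herm (s := p) (by simp) hyp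
  have hK : ConnOn A {z, y, x, p} := by
    by_cases hzp : p = z
    · subst hzp
      rwa [Finset.insert_eq_of_mem (by simp)]
    · exact hKp.insert_vertex G.herm (s := p) (by simp) ((h2 p (Finset.mem_univ p) hpx hzp).1 hxp)
  obtain ⟨C, _, _, col, hcol, heq⟩ := G.exists_local hK (Finset.card_le_four.trans (by omega))
  rcases hcol.fiber x (by simp) y (by simp) z (by simp)
    ((heq x (by simp) y (by simp) hxy).2 h1) ((heq x (by simp) z (by simp) hxz).2 h2)
    with h | h | h
  exacts [hxy h, hxz h, hyz h]

/-- No vertex has neighbours in three classes of twins other than its own. -/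
theorem LocallyColumnar.nontwin_neighbours (G : LocallyColumnar ω A) {y p q r : V}
    (hp : A y p ≠ 0) (hq : A y q ≠ 0) (hr : A y r ≠ 0)
    (hyp : ¬TwinOn A Finset.univ y p) (hyq : ¬TwinOn A Finset.univ y q)
    (hyr : ¬TwinOn A Finset.univ y r) (hpq : ¬TwinOn A Finset.univ p q)
    (hpr : ¬TwinOn A Finset.univ p r) (hqr : ¬TwinOn A Finset.univ q r) : False := by
  have hK : ConnOn A {r, q, p, y} :=
    (((connOn_singleton y).insert_vertex G.herm (Finset.mem_singleton_self y)
      (ne_zero_symm G.herm hp)).insert_vertex G.herm (s := y) (by simp)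
      (ne_zero_symm G.herm hq)).insert_vertex G.herm (s := y) (by simp) (ne_zero_symm G.herm hr)
  obtain ⟨C, _, _, col, hcol, heq⟩ := G.exists_local hK (Finset.card_le_four.trans (by omega))
  have ne : ∀ a ∈ ({r, q, p, y} : Finset V), ∀ b ∈ ({r, q, p, y} : Finset V),
      ¬TwinOn A Finset.univ a b → col a ≠ col b := by
    intro a ha b hb hab
    rwa [ne_eq, heq a ha b hb (by rintro rfl; exact hab fun z _ _ _ => Iff.rfl)]
  have nb : ∀ b ∈ ({r, q, p, y} : Finset V), A y b ≠ 0 → ¬TwinOn A Finset.univ y b →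
      Nb (col y) (col b) := fun b hb h0 hab =>
    (hcol.near y (by simp) b hb h0).resolve_left (ne y (by simp) b hb hab)
  rcases Nb.two_of_three (nb p (by simp) hp hyp) (nb q (by simp) hq hyq) (nb r (by simp) hr hyr)
    with h | h | h
  exacts [ne p (by simp) q (by simp) hpq h, ne p (by simp) r (by simp) hpr h,
    ne q (by simp) r (by simp) hqr h]

/-- A column map whose columns are the classes of twins and whose neighbouring columns are the
adjacent classes. -/
structure IsTwinMap {C : Type*} [CommRing C] (A : Matrix V V ℂ) (col : V → C) : Prop where
  near : ∀ x y, A x y ≠ 0 → col x = col y ∨ Nb (col x) (col y)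
  ne_zero : ∀ x y, Nb (col x) (col y) → A x y ≠ 0
  eq_iff : ∀ x y, x ≠ y → (col x = col y ↔ TwinOn A Finset.univ x y)

theorem LocallyColumnar.colStr_on (G : LocallyColumnar ω A) {C : Type*} [CommRing C] [FarCols C]
    {col : V → C} (h : IsTwinMap A col) {K : Finset V} (hK : ConnOn A K) (hcard : K.card ≤ 10) :
    ColStr ω A K col := by
  obtain ⟨C', _, _, col', hcol', heq'⟩ := G.exists_local hK hcard
  have heq : ∀ x ∈ K, ∀ y ∈ K, col x = col y ↔ col' x = col' y := by
    intro x hx y hy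
    by_cases hxy : x = y
    · simp [hxy]
    · rw [h.eq_iff x y hxy, heq' x hx y hy hxy]
  refine hcol'.of_iff subset_rfl heq fun x hx y hy => ⟨fun hn => ?_, fun hn => ?_⟩
  · exact (hcol'.near x hx y hy (h.ne_zero x y hn)).resolve_left
      fun h1 => hn.ne ((heq x hx y hy).2 h1)
  · exact (h.near x y (hcol'.ne_zero G.ne_zero hx hy hn)).resolve_left
      fun h1 => hn.ne ((heq x hx y hy).1 h1)

theorem LocallyColumnar.heavy_univ (G : LocallyColumnar ω A) {C : Type*} [CommRing C]
    [FarCols C] {col : V → C} (h : IsTwinMap A col) (x y : V) (hxy : Nb (col x) (col y))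
    (hne : A x y * A y x ≠ 1) :
    (A x x = 0 ∧ ∀ z ∈ (Finset.univ : Finset V),
      (col z = col x → z = x) ∧ (Nb (col x) (col z) → col z = col y)) ∨
    (A y y = 0 ∧ ∀ z ∈ (Finset.univ : Finset V),
      (col z = col y → z = y) ∧ (Nb (col y) (col z) → col z = col x)) := by
  -- A failure of either alternative is caused by a single vertex.
  have wit : ∀ x y, Nb (col x) (col y) → (¬(A x x = 0 ∧ ∀ z ∈ (Finset.univ : Finset V),
      (col z = col x → z = x) ∧ (Nb (col x) (col z) → col z = col y))) →
      ∃ z, (A z x ≠ 0 ∨ A z y ≠ 0 ∨ z = x) ∧ ¬(A x x = 0 ∧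
        (col z = col x → z = x) ∧ (Nb (col x) (col z) → col z = col y)) := by
    intro x y hxy hw
    by_contra! hcon
    refine hw ⟨(hcon x (Or.inr (Or.inr rfl))).1, fun z _ => ⟨fun hz => ?_, fun hz => ?_⟩⟩
    · exact (hcon z (Or.inr (Or.inl (h.ne_zero z y (hz ▸ hxy))))).2.1 hz
    · exact (hcon z (Or.inl (h.ne_zero z x hz.symm))).2.2 hz
  have ins : ∀ {S : Finset V} {z : V}, ConnOn A S → x ∈ S → y ∈ S →
      A z x ≠ 0 ∨ A z y ≠ 0 ∨ z = x ∨ z = y → ConnOn A (insert z S) := by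
    intro S z hS hx hy hz
    rcases hz with hz | hz | rfl | rfl
    · exact hS.insert_vertex G.herm hx hz
    · exact hS.insert_vertex G.herm hy hz
    · rwa [Finset.insert_eq_of_mem hx]
    · rwa [Finset.insert_eq_of_mem hy]
  have hK : ConnOn A {x, y} := (connOn_singleton y).insert_vertex G.herm
    (Finset.mem_singleton_self y) (h.ne_zero x y hxy)
  by_contra hcon
  rw [not_or] at hcon
  obtain ⟨z, hz, hz'⟩ := wit x y hxy hcon.1
  obtain ⟨w, hw, hw'⟩ := wit y x hxy.symm hcon.2
  have hKz : ConnOn A {z, x, y} := ins hK (by simp) (by simp)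
    (hz.imp_right (Or.imp_right Or.inl))
  have hKw : ConnOn A {w, z, x, y} := ins hKz (by simp) (by simp)
    (by rcases hw with hw | hw | hw <;> simp [hw])
  have hc := G.colStr_on h hKw (Finset.card_le_four.trans (by omega))
  rcases hc.heavy x (by simp) y (by simp) hxy hne with h1 | h1
  · exact hz' ⟨h1.1, h1.2 z (by simp)⟩
  · exact hw' ⟨h1.1, h1.2 w (by simp)⟩

/-- The conditions on a column structure involve at most four vertices at a time, which lie in a
small connected set; so they hold for every column map that separates vertices correctly. -/
theorem LocallyColumnar.colStr_univ (G : LocallyColumnar ω A) {C : Type*} [CommRing C]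
    [FarCols C] {col : V → C} (h : IsTwinMap A col) : ColStr ω A Finset.univ col := by
  have adj : ∀ {x y : V}, Nb (col x) (col y) → A x y ≠ 0 := fun hn => h.ne_zero _ _ hn
  have one : ∀ x, ColStr ω A {x} col := fun x => G.colStr_on h (connOn_singleton x) (by simp)
  have two : ∀ {x p}, A p x ≠ 0 → ConnOn A {p, x} := fun hp =>
    (connOn_singleton _).insert_vertex G.herm (Finset.mem_singleton_self _) hp
  have card4 : ∀ a b c d : V, ({a, b, c, d} : Finset V).card ≤ 10 := fun a b c d =>
    Finset.card_le_four.trans (by omega)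
  have card3 : ∀ a b c : V, ({a, b, c} : Finset V).card ≤ 10 := fun a b c =>
    Finset.card_le_three.trans (by omega)
  refine ⟨fun x _ y _ => h.near x y, fun x _ y _ hn => ?_, fun x _ y _ z _ hxy hxz => ?_,
    fun x _ => (one x).charge x (by simp), ?_, ?_, ?_, ?_, ?_, ?_⟩
  · exact (G.colStr_on h (two (adj hn)) (Finset.card_le_two.trans (by omega))).label
      x (by simp) y (by simp) hn
  · by_contra! hne
    exact G.twin_unique hne.1 hne.2.1 hne.2.2 ((h.eq_iff x y hne.1).1 hxy)
      ((h.eq_iff x z hne.2.1).1 hxz)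
  · intro x _ y _ p _ q _ hxy hpq hxp
    refine (G.colStr_on h (((two (adj hxp)).insert_vertex G.herm (v := y) (s := p) (by simp)
      (adj (hxy ▸ hxp))).insert_vertex G.herm (v := q) (s := x) (by simp)
      (adj (hpq ▸ hxp).symm)) (card4 _ _ _ _)).same x ?_ y ?_ p ?_ q ?_ hxy hpq hxp <;> simp
  · intro x _ y _ p _ q _ hne hxy hpq hxp hxq
    refine (G.colStr_on h (((two (adj hxp)).insert_vertex G.herm (v := y) (s := p) (by simp)
      (adj (hxy ▸ hxp))).insert_vertex G.herm (v := q) (s := x) (by simp)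
      (adj hxq.symm)) (card4 _ _ _ _)).opp x ?_ y ?_ p ?_ q ?_ hne hxy hpq hxp hxq <;> simp
  · intro x _ y _ p _ hxy hxp
    refine (G.colStr_on h ((two (adj hxp)).insert_vertex G.herm (v := y) (s := p) (by simp)
      (adj (hxy ▸ hxp))) (card3 _ _ _)).ratio x ?_ y ?_ p ?_ hxy hxp <;> simp
  · intro x _ y _ p _ hne hxy hxp
    refine (G.colStr_on h ((two (adj hxp)).insert_vertex G.herm (v := y) (s := p) (by simp)
      (adj (hxy ▸ hxp))) (card3 _ _ _)).twin x ?_ y ?_ p ?_ hne hxy hxp <;> simp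
  · intro x _ p _ q _ hx hxp hxq
    refine (G.colStr_on h ((two (adj hxp)).insert_vertex G.herm (v := q) (s := x) (by simp)
      (adj hxq.symm)) (card3 _ _ _)).charge_end x ?_ p ?_ q ?_ hx hxp hxq <;> simp
  · exact fun x _ y _ => G.heavy_univ h x y

end Local

/-! ### Adding a vertex to a column structure -/

section Extend

variable {V : Type*} {ω : ℂ} {A : Matrix V V ℂ}

theorem int_nb_zmod_val {m : ℕ} [NeZero m] (hm : 2 ≤ m) {a b : ZMod m} (hb : b ≠ 0) :
    (b.val : ℤ) = a.val + 1 ↔ b = a + 1 := by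
  constructor
  · intro h
    have h' : b.val = a.val + 1 := by exact_mod_cast h
    rw [← ZMod.natCast_zmod_val b, h', Nat.cast_add, ZMod.natCast_zmod_val, Nat.cast_one]
  · rintro rfl
    have : Fact (1 < m) := ⟨hm⟩
    have h1 := ZMod.val_add a 1
    rw [ZMod.val_one] at h1
    have h2 := ZMod.val_lt a
    rcases Nat.lt_or_ge (a.val + 1) m with h3 | h3
    · rw [Nat.mod_eq_of_lt h3] at h1
      exact_mod_cast h1
    · rw [show a.val + 1 = m by omega, Nat.mod_self] at h1
      exact absurd ((ZMod.val_eq_zero _).1 h1) hb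

/-- A cycle of columns can be cut at an empty column. -/
theorem ColStr.cut {S : Finset V} {m : ℕ} (hm : 5 ≤ m) {col : V → ZMod m}
    (h : ColStr ω A S col) {c : ZMod m} (hc : ∀ x ∈ S, col x ≠ c) :
    ColStr ω A S fun x => ((col x - c).val : ℤ) := by
  have : NeZero m := ⟨by omega⟩
  have step : ∀ x ∈ S, ∀ y ∈ S,
      (((col y - c).val : ℤ) = (col x - c).val + 1 ↔ col y = col x + 1) := by
    intro x _ y hy
    rw [int_nb_zmod_val (by omega) (sub_ne_zero.2 (hc y hy))]
    constructor <;> intro h <;> linear_combination h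
  refine h.of_iff subset_rfl (fun x _ y _ => ?_) fun x hx y hy =>
    or_congr (step x hx y hy) (step y hy x hx)
  rw [Nat.cast_inj, (ZMod.val_injective m).eq_iff, sub_left_inj]

theorem ColStr.exists_col_eq {S : Finset V} {col : V → ℤ} (h : ColStr ω A S col)
    (hS : ConnOn A S) {a b : V} (ha : a ∈ S) (hb : b ∈ S) {c : ℤ} (hac : col a ≤ c)
    (hcb : c ≤ col b) : ∃ x ∈ S, col x = c := by
  classical
  by_contra! hcon
  have hsub : S ⊆ S.filter fun x => col x < c := by
    refine hS.2 _ (Finset.filter_subset _ _)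
      ⟨a, Finset.mem_filter.2 ⟨ha, lt_of_le_of_ne hac (hcon a ha)⟩⟩ ?_
    intro x hx y hy hxy
    obtain ⟨hx, hxc⟩ := Finset.mem_filter.1 hx
    have hyc := hcon y hy
    refine Finset.mem_filter.2 ⟨hy, ?_⟩
    rcases h.near x hx y hy hxy with h1 | h1 | h1 <;> omega
  have := (Finset.mem_filter.1 (hsub hb)).2
  omega

variable [Fintype V] [DecidableEq V]

theorem LocallyColumnar.exists_erase (G : LocallyColumnar ω A) :
    ∃ v, ConnOn A (Finset.univ.erase v) := by
  obtain ⟨x, hx⟩ := G.conn.1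
  have hc := G.card
  obtain ⟨T, -, -, hT, hcard⟩ := (connOn_singleton (A := A) x).exists_between G.herm G.conn
    (Finset.subset_univ _) (k := Fintype.card V - 1) (by simp; omega)
    (by rw [Finset.card_univ]; omega)
  obtain ⟨v, hv⟩ : ∃ v, v ∉ T := by
    by_contra! hcon
    rw [Finset.eq_univ_iff_forall.2 hcon, Finset.card_univ] at hcard
    omega
  refine ⟨v, ?_⟩
  rwa [← Finset.eq_of_subset_of_card_le (s := T) (t := Finset.univ.erase v)
    (fun y hy => Finset.mem_erase.2 ⟨fun h => hv (h ▸ hy), Finset.mem_univ y⟩)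
    (by rw [Finset.card_erase_of_mem (Finset.mem_univ v), Finset.card_univ, hcard])]

variable {C C' : Type*} [CommRing C] [CommRing C'] [FarCols C] [FarCols C'] {v : V}
  {col : V → C} {col' : V → C'}

theorem LocallyColumnar.card_erase (G : LocallyColumnar ω A) (v : V) :
    10 ≤ (Finset.univ.erase v).card := by
  rw [Finset.card_erase_of_mem (Finset.mem_univ v), Finset.card_univ]
  have := G.card
  omega

/-- A vertex with a twin is put into the column of its twin. -/
theorem LocallyColumnar.isTwinMap_of_twin (G : LocallyColumnar ω A)
    (hX : ConnOn A (Finset.univ.erase v)) (h : ColStr ω A (Finset.univ.erase v) col) {x : V}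
    (hx : x ≠ v) (ht : TwinOn A Finset.univ v x) :
    IsTwinMap A (Function.update col v (col x)) := by
  have mem : ∀ {y}, y ≠ v → y ∈ Finset.univ.erase v := fun hy => by simp [hy]
  have near : ∀ b, b ≠ v → A v b ≠ 0 → col x = col b ∨ Nb (col x) (col b) := by
    intro b hb h0
    by_cases hbx : b = x
    · exact Or.inl (by rw [hbx])
    · exact h.near x (mem hx) b (mem hb) ((ht b (Finset.mem_univ b) hb hbx).1 h0)
  have nz : ∀ b, b ≠ v → Nb (col x) (col b) → A v b ≠ 0 := by
    intro b hb h0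
    have hbx : b ≠ x := by rintro rfl; exact h0.ne rfl
    exact (ht b (Finset.mem_univ b) hb hbx).2 (h.ne_zero G.ne_zero (mem hx) (mem hb) h0)
  have eq : ∀ b, b ≠ v → (col x = col b ↔ TwinOn A Finset.univ v b) := by
    intro b hb
    by_cases hbx : b = x
    · simp [hbx, ht]
    · refine iff_of_false (fun h1 => ?_) fun h1 => ?_
      · exact G.twin_unique (Ne.symm hbx) hx hb
          ((G.col_eq_iff hX (G.card_erase v) h (mem hx) (mem hb) (Ne.symm hbx)).1 h1) ht.symm
      · exact G.twin_unique hx.symm hb.symm (Ne.symm hbx) ht h1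
  refine ⟨fun a b hab => ?_, fun a b hab => ?_, fun a b hne => ?_⟩
  · rcases eq_or_ne a v with rfl | ha <;> rcases eq_or_ne b a with rfl | hb
    · exact Or.inl rfl
    · simpa [hb] using near b hb hab
    · exact Or.inl rfl
    · rcases eq_or_ne b v with rfl | hbv
      · simpa [ha, eq_comm] using (near a ha (ne_zero_symm G.herm hab)).imp_right Nb.symm
      · simpa [ha, hbv] using h.near a (mem ha) b (mem hbv) hab
  · rcases eq_or_ne a v with rfl | ha
    · rcases eq_or_ne b a with rfl | hb
      · exact absurd rfl hab.ne
      · exact nz b hb (by simpa [hb] using hab)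
    · rcases eq_or_ne b v with rfl | hb
      · exact ne_zero_symm G.herm (nz a ha (by simpa [ha] using hab.symm))
      · exact h.ne_zero G.ne_zero (mem ha) (mem hb) (by simpa [ha, hb] using hab)
  · rcases eq_or_ne a v with rfl | ha
    · simpa [hne.symm] using eq b hne.symm
    · rcases eq_or_ne b v with rfl | hb
      · have := eq a ha
        simp only [Function.update_self, Function.update_of_ne ha]
        exact ⟨fun h1 => (this.1 h1.symm).symm, fun h1 => (this.2 h1.symm).symm⟩
      · simpa [ha, hb] using G.col_eq_iff hX (G.card_erase v) h (mem ha) (mem hb) hne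

/-- A vertex without a twin is put into a column of its own, whose neighbours are the columns to
which it is adjacent. -/
theorem LocallyColumnar.isTwinMap_of_not_twin (G : LocallyColumnar ω A)
    (hX : ConnOn A (Finset.univ.erase v)) (h : ColStr ω A (Finset.univ.erase v) col)
    (ht : ∀ x, x ≠ v → ¬TwinOn A Finset.univ v x)
    (heq : ∀ x y, x ≠ v → y ≠ v → (col' x = col' y ↔ col x = col y))
    (hnb : ∀ x y, x ≠ v → y ≠ v → (Nb (col' x) (col' y) ↔ Nb (col x) (col y)))
    (hv : ∀ y, y ≠ v → col' v ≠ col' y)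
    (hvnb : ∀ y, y ≠ v → (Nb (col' v) (col' y) ↔ A v y ≠ 0)) : IsTwinMap A col' := by
  have mem : ∀ {y}, y ≠ v → y ∈ Finset.univ.erase v := fun hy => by simp [hy]
  refine ⟨fun a b hab => ?_, fun a b hab => ?_, fun a b hne => ?_⟩
  · rcases eq_or_ne a v with rfl | ha
    · rcases eq_or_ne b a with rfl | hb
      · exact Or.inl rfl
      · exact Or.inr ((hvnb b hb).2 hab)
    · rcases eq_or_ne b v with rfl | hb
      · exact Or.inr ((hvnb a ha).2 (ne_zero_symm G.herm hab)).symm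
      · rw [heq a b ha hb, hnb a b ha hb]
        exact h.near a (mem ha) b (mem hb) hab
  · rcases eq_or_ne a v with rfl | ha
    · rcases eq_or_ne b a with rfl | hb
      · exact absurd rfl hab.ne
      · exact (hvnb b hb).1 hab
    · rcases eq_or_ne b v with rfl | hb
      · exact ne_zero_symm G.herm ((hvnb a ha).1 hab.symm)
      · exact h.ne_zero G.ne_zero (mem ha) (mem hb) ((hnb a b ha hb).1 hab)
  · rcases eq_or_ne a v with rfl | ha
    · exact iff_of_false (hv b hne.symm) (ht b hne.symm)
    · rcases eq_or_ne b v with rfl | hb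
      · exact iff_of_false (hv a ha).symm fun h1 => ht a ha h1.symm
      · rw [heq a b ha hb]
        exact G.col_eq_iff hX (G.card_erase v) h (mem ha) (mem hb) hne

/-- A vertex without a twin is not adjacent to a column that already has neighbours on both
sides. -/
theorem LocallyColumnar.not_adj_inner (G : LocallyColumnar ω A)
    (hX : ConnOn A (Finset.univ.erase v)) (h : ColStr ω A (Finset.univ.erase v) col)
    (ht : ∀ x, x ≠ v → ¬TwinOn A Finset.univ v x) {y p q : V} (hy : y ≠ v) (hp : p ≠ v)
    (hq : q ≠ v) (hyp : col p = col y + 1) (hyq : col y = col q + 1) : A v y = 0 := by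
  by_contra h0
  have mem : ∀ {y}, y ≠ v → y ∈ Finset.univ.erase v := fun hy => by simp [hy]
  have ne : ∀ {a b}, a ≠ v → b ≠ v → col a ≠ col b → ¬TwinOn A Finset.univ a b :=
    fun ha hb hab h1 => hab ((G.col_eq_iff hX (G.card_erase v) h (mem ha) (mem hb)
      fun h2 => hab (congrArg col h2)).2 h1)
  have hp' : Nb (col y) (col p) := Or.inl hyp
  have hq' : Nb (col y) (col q) := Or.inr hyq
  refine G.nontwin_neighbours (h.ne_zero G.ne_zero (mem hy) (mem hp) hp')
    (h.ne_zero G.ne_zero (mem hy) (mem hq) hq') (ne_zero_symm G.herm h0) (ne hy hp hp'.ne)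
    (ne hy hq hq'.ne) (fun h1 => ht y hy h1.symm) (ne hp hq fun h1 => ?_)
    (fun h1 => ht p hp h1.symm) fun h1 => ht q hq h1.symm
  exact FarCols.two (C := C) (by linear_combination h1 - hyp - hyq)

end Extend

section Global

variable {V : Type*} [Fintype V] [DecidableEq V] {ω : ℂ} {A : Matrix V V ℂ} {v : V}

theorem zmod_cast_eq_iff {m : ℕ} {a b : ℤ} (h1 : a - b < m) (h2 : b - a < m) :
    ((a : ℤ) : ZMod m) = b ↔ a = b := by
  constructor
  · intro h
    have := Int.eq_zero_of_abs_lt_dvd ((ZMod.intCast_eq_intCast_iff_dvd_sub a b m).1 h)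
      (abs_lt.2 ⟨by omega, by omega⟩)
    omega
  · rintro rfl; rfl

/-- A line of columns is extended by a vertex without a twin. The new vertex is adjacent to end
columns only: to one of them, which makes it a new end, or to both, which closes the line up to a
cycle. -/
theorem LocallyColumnar.extend_line (G : LocallyColumnar ω A)
    (hX : ConnOn A (Finset.univ.erase v)) {col : V → ℤ}
    (h : ColStr ω A (Finset.univ.erase v) col)
    (ht : ∀ x, x ≠ v → ¬TwinOn A Finset.univ v x) :
    (∃ col' : V → ℤ, ColStr ω A Finset.univ col') ∨
      ∃ m : ℕ, 5 ≤ m ∧ ∃ col' : V → ZMod m, Function.Surjective col' ∧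
        ColStr ω A Finset.univ col' := by
  have mem : ∀ {y}, y ≠ v → y ∈ Finset.univ.erase v := fun hy => by simp [hy]
  have mem' : ∀ {y}, y ∈ Finset.univ.erase v → y ≠ v := fun hy => (Finset.mem_erase.1 hy).1
  obtain ⟨a, ha, hmin⟩ := Finset.exists_min_image _ col hX.1
  obtain ⟨b, hb, hmax⟩ := Finset.exists_max_image _ col hX.1
  have bd : ∀ y, y ≠ v → col a ≤ col y ∧ col y ≤ col b := fun y hy =>
    ⟨hmin y (mem hy), hmax y (mem hy)⟩
  have ends : ∀ y, y ≠ v → A v y ≠ 0 → col y = col a ∨ col y = col b := by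
    intro y hy h0
    by_contra! hcon
    obtain ⟨h1, h2⟩ := bd y hy
    obtain ⟨p, hp, hpc⟩ := h.exists_col_eq hX (mem hy) hb (c := col y + 1) (by omega) (by omega)
    obtain ⟨q, hq, hqc⟩ := h.exists_col_eq hX ha (mem hy) (c := col y - 1) (by omega) (by omega)
    exact h0 (G.not_adj_inner hX h ht hy (mem' hp) (mem' hq) hpc (by omega))
  have full : ∀ x y, x ≠ v → y ≠ v → col x = col y → A v x ≠ 0 → A v y ≠ 0 := by
    intro x y hx hy hxy h0
    by_cases hne : x = y
    · exact hne ▸ h0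
    · exact ne_zero_symm G.herm ((((G.col_eq_iff hX (G.card_erase v) h (mem hx) (mem hy) hne).1 hxy)
        v (Finset.mem_univ v) hx.symm hy.symm).1 (ne_zero_symm G.herm h0))
  obtain ⟨w, hw, hvw⟩ : ∃ w, w ≠ v ∧ A v w ≠ 0 := by
    by_contra! hcon
    have h1 := G.conn.2 {v} (Finset.subset_univ _) ⟨v, by simp⟩ fun x hx y _ hxy => by
      rw [Finset.mem_singleton] at hx ⊢
      subst hx
      by_contra hne
      exact hxy (hcon y hne)
    have h2 := Finset.card_le_card h1
    rw [Finset.card_univ, Finset.card_singleton] at h2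
    have := G.card
    omega
  have hwide : col a + 4 ≤ col b := by
    have h1 := h.card_le (Finset.Icc (col a) (col b)) fun x hx =>
      Finset.mem_Icc.2 (bd x (mem' hx))
    have h2 := G.card_erase v
    rw [Int.card_Icc] at h1
    omega
  -- A new column `c` at one end.
  have one : ∀ c : ℤ, (c = col a - 1 ∨ c = col b + 1) →
      (∀ y, y ≠ v → (Nb c (col y) ↔ A v y ≠ 0)) →
      ∃ col' : V → ℤ, ColStr ω A Finset.univ col' := by
    intro c hc hcn
    refine ⟨Function.update col v c, G.colStr_univ (G.isTwinMap_of_not_twin hX h ht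
      (fun x y hx hy => by simp [hx, hy]) (fun x y hx hy => by simp [hx, hy])
      (fun y hy => ?_) fun y hy => ?_)⟩
    · have := bd y hy
      rw [Function.update_self, Function.update_of_ne hy]
      omega
    · rw [Function.update_self, Function.update_of_ne hy]
      exact hcn y hy
  by_cases hL : A v a = 0
  · left
    refine one (col b + 1) (Or.inr rfl) fun y hy => ⟨fun h1 => ?_, fun h1 => ?_⟩
    · have h2 : col y = col b := by
        have := bd y hy
        rcases h1 with h1 | h1 <;> omega
      have h3 : col w = col b := (ends w hw hvw).resolve_left fun h3 =>
        full w a hw (mem' ha) h3 hvw hL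
      exact full w y hw hy (h3.trans h2.symm) hvw
    · rcases ends y hy h1 with h2 | h2
      · exact absurd hL (full y a hy (mem' ha) h2 h1)
      · exact Or.inr (by omega)
  by_cases hR : A v b = 0
  · left
    refine one (col a - 1) (Or.inl rfl) fun y hy => ⟨fun h1 => ?_, fun h1 => ?_⟩
    · have h2 : col y = col a := by
        have := bd y hy
        rcases h1 with h1 | h1 <;> omega
      have h3 : col w = col a := (ends w hw hvw).resolve_right fun h3 =>
        full w b hw (mem' hb) h3 hvw hR
      exact full w y hw hy (h3.trans h2.symm) hvw
    · rcases ends y hy h1 with h2 | h2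
      · exact Or.inl (by omega)
      · exact absurd hR (full y b hy (mem' hb) h2 h1)
  right
  obtain ⟨m, hm⟩ : ∃ m : ℕ, (m : ℤ) = col b - col a + 2 :=
    ⟨(col b - col a + 2).toNat, Int.toNat_of_nonneg (by omega)⟩
  have := farCols_zmod (m := m) (by omega)
  set pos : V → ℤ := fun z => if z = v then -1 else col z - col a with hpos
  have posv : pos v = -1 := by simp [hpos]
  have posy : ∀ {y}, y ≠ v → pos y = col y - col a := fun hy => by simp [hpos, hy]
  have succ_iff : ∀ s t : ℤ, -1 ≤ s → s + 2 ≤ m → -1 ≤ t → t + 2 ≤ m →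
      (((t : ℤ) : ZMod m) = (s : ℤ) + 1 ↔ t = s + 1 ∨ (t = -1 ∧ s + 2 = m)) := by
    intro s t hs hs' ht ht'
    by_cases hwrap : t = -1 ∧ s + 2 = m
    · refine iff_of_true ?_ (Or.inr hwrap)
      have : ((s + 2 : ℤ) : ZMod m) = 0 := by rw [hwrap.2]; simp
      push_cast at this
      rw [hwrap.1]
      push_cast
      linear_combination -this
    · rw [or_iff_left hwrap]
      have := zmod_cast_eq_iff (m := m) (a := t) (b := s + 1) (by omega) (by omega)
      push_cast at this
      exact this
  refine ⟨m, by omega, fun z => (pos z : ZMod m), ?_, G.colStr_univ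
    (G.isTwinMap_of_not_twin (col := col) (col' := fun z => (pos z : ZMod m)) hX h ht
      (fun x y hx hy => ?_) (fun x y hx hy => ?_) (fun y hy => ?_) fun y hy => ?_)⟩
  · intro c
    have : NeZero m := ⟨by omega⟩
    have hlt := ZMod.val_lt c
    by_cases hc : (c.val : ℤ) + 1 = m
    · refine ⟨v, ?_⟩
      have h1 : (((c.val : ℤ) + 1 : ℤ) : ZMod m) = 0 := by rw [hc]; simp
      push_cast [ZMod.natCast_zmod_val] at h1
      simp only [posv]
      push_cast
      linear_combination -h1
    · obtain ⟨y, hy, hyc⟩ := h.exists_col_eq hX ha hb (c := col a + c.val) (by omega) (by omega)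
      refine ⟨y, ?_⟩
      simp only [posy (mem' hy), hyc]
      simp
  · have h1 := bd x hx
    have h2 := bd y hy
    simp only [posy hx, posy hy]
    rw [zmod_cast_eq_iff (by omega) (by omega)]
    omega
  · have h1 := bd x hx
    have h2 := bd y hy
    simp only [posy hx, posy hy, Nb]
    rw [succ_iff _ _ (by omega) (by omega) (by omega) (by omega),
      succ_iff _ _ (by omega) (by omega) (by omega) (by omega)]
    omega
  · have h1 := bd y hy
    simp only [posy hy, posv]
    rw [ne_eq, zmod_cast_eq_iff (by omega) (by omega)]
    omega
  · have h1 := bd y hy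
    have h2 : Nb ((pos v : ZMod m)) (pos y : ZMod m) ↔ col y = col a ∨ col y = col b := by
      simp only [posy hy, posv, Nb]
      rw [succ_iff _ _ (by omega) (by omega) (by omega) (by omega),
        succ_iff _ _ (by omega) (by omega) (by omega) (by omega)]
      omega
    refine h2.trans ⟨fun h3 => ?_, ends y hy⟩
    rcases h3 with h3 | h3
    · exact full a y (mem' ha) hy h3.symm hL
    · exact full b y (mem' hb) hy h3.symm hR

/-- The whole graph has a column structure, on a line or on a cycle without empty columns. -/
theorem LocallyColumnar.exists_colStr (G : LocallyColumnar ω A) :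
    (∃ col : V → ℤ, ColStr ω A Finset.univ col) ∨
      ∃ m : ℕ, 5 ≤ m ∧ ∃ col : V → ZMod m, Function.Surjective col ∧
        ColStr ω A Finset.univ col := by
  obtain ⟨v, hX⟩ := G.exists_erase
  have line : ∀ col : V → ℤ, ColStr ω A (Finset.univ.erase v) col →
      (∃ col : V → ℤ, ColStr ω A Finset.univ col) ∨
        ∃ m : ℕ, 5 ≤ m ∧ ∃ col : V → ZMod m, Function.Surjective col ∧
          ColStr ω A Finset.univ col := fun col hcol => by
    by_cases ht : ∃ x, x ≠ v ∧ TwinOn A Finset.univ v x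
    · obtain ⟨x, hx, ht⟩ := ht
      exact Or.inl ⟨_, G.colStr_univ (G.isTwinMap_of_twin hX hcol hx ht)⟩
    · push Not at ht
      exact G.extend_line hX hcol ht
  rcases G.proper _ hX (fun h => Finset.erase_ne_self.2 (Finset.mem_univ v) h)
    (G.card_erase v) with ⟨col, hcol⟩ | ⟨m, hm, col, hcol⟩
  · exact line col hcol
  by_cases hc : ∃ c, ∀ x ∈ Finset.univ.erase v, col x ≠ c
  · obtain ⟨c, hc⟩ := hc
    exact line _ (hcol.cut hm hc)
  push Not at hc
  have := farCols_zmod (m := m) (by omega)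
  by_cases ht : ∃ x, x ≠ v ∧ TwinOn A Finset.univ v x
  · obtain ⟨x, hx, ht⟩ := ht
    refine Or.inr ⟨m, hm, _, fun c => ?_, G.colStr_univ (G.isTwinMap_of_twin hX hcol hx ht)⟩
    obtain ⟨y, hy, hyc⟩ := hc c
    exact ⟨y, by rw [Function.update_of_ne (Finset.mem_erase.1 hy).1, hyc]⟩
  · push Not at ht
    exfalso
    have hv : Finset.univ ⊆ {v} := G.conn.2 {v} (Finset.subset_univ _) ⟨v, by simp⟩
      fun x hx y _ hxy => by
        rw [Finset.mem_singleton] at hx ⊢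
        subst hx
        by_contra hy
        obtain ⟨p, hp, hpc⟩ := hc (col y + 1)
        obtain ⟨q, hq, hqc⟩ := hc (col y - 1)
        exact hxy (G.not_adj_inner hX hcol ht hy (Finset.mem_erase.1 hp).1
          (Finset.mem_erase.1 hq).1 hpc (by rw [hqc]; ring))
    have h2 := Finset.card_le_card hv
    rw [Finset.card_univ, Finset.card_singleton] at h2
    have := G.card
    omega

end Global

/-! ### The model of a ladder with ends -/

/-- The universal ladder: the vertices of column `c` are joined to those of column `c + 1` with
labels `g c` (top row) and `-g c` (bottom row), both vertices of column `c` have charge `h c`, and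
they are joined by an edge with label `o c`. All graphs of the families are subgraphs of such
ladders. -/
noncomputable def ladderModel {C : Type*} [CommRing C] (g h o : C → ℂ) (p q : C × Fin 2) : ℂ :=
  open Classical in
  if q.1 = p.1 + 1 then rowSign p.2 * g p.1
  else if p.1 = q.1 + 1 then rowSign q.2 * (starRingEnd ℂ) (g q.1)
  else if p.1 = q.1 then (if p.2 = q.2 then h p.1 else o p.1)
  else 0

/-- Conditions on the labels under which the part `P` of the universal ladder has a column
structure: columns with charges, and edges of weight other than `1`, occur only at the ends. -/
structure LadderLabels {C : Type*} [CommRing C] (ω : ℂ) (g h o : C → ℂ)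
    (P : Set (C × Fin 2)) : Prop where
  edge : ∀ c, g c ∈ edgeLabels ω
  charge : ∀ c, h c = 0 ∨ h c = 1 ∨ h c = -1
  ends : ∀ p ∈ P, (h p.1 = 0 ∧ o p.1 = 0) ∨ (o p.1 = h p.1 ∧ ∀ q ∈ P, p.1 ≠ q.1 + 1) ∨
    (o p.1 = -h p.1 ∧ ∀ q ∈ P, q.1 ≠ p.1 + 1)
  heavy : ∀ p ∈ P, ∀ q ∈ P, q.1 = p.1 + 1 → g p.1 * (starRingEnd ℂ) (g p.1) ≠ 1 →
    (h p.1 = 0 ∧ ∀ r ∈ P, (r.1 = p.1 → r = p) ∧ p.1 ≠ r.1 + 1) ∨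
    (h q.1 = 0 ∧ ∀ r ∈ P, (r.1 = q.1 → r = q) ∧ r.1 ≠ q.1 + 1)

section Model

variable {C : Type*} [CommRing C] [FarCols C] {g h o : C → ℂ} {p q : C × Fin 2} {ω : ℂ}

theorem edgeLabels_conj {z : ℂ} (hz : z ∈ edgeLabels ω) : (starRingEnd ℂ) z ∈ edgeLabels ω := by
  simp only [edgeLabels, Set.mem_insert_iff, Set.mem_singleton_iff] at hz ⊢
  rcases hz with rfl | rfl | rfl | rfl | rfl | rfl <;> simp

theorem edgeLabels_neg {z : ℂ} (hz : z ∈ edgeLabels ω) : -z ∈ edgeLabels ω := by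
  simp only [edgeLabels, Set.mem_insert_iff, Set.mem_singleton_iff] at hz ⊢
  rcases hz with rfl | rfl | rfl | rfl | rfl | rfl <;> simp

theorem edgeLabels_unit_mul {z : ℂ} (s : ℤˣ) (hz : z ∈ edgeLabels ω) :
    ((s : ℤ) : ℂ) * z ∈ edgeLabels ω := by
  rcases Int.units_eq_one_or s with rfl | rfl
  · simpa using hz
  · simpa using edgeLabels_neg hz

theorem rowSign_eq (r : Fin 2) : rowSign r = 1 ∨ rowSign r = -1 := by
  unfold rowSign; split_ifs <;> simp

theorem rowSign_sq (r : Fin 2) : rowSign r * rowSign r = 1 := by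
  rcases rowSign_eq r with h | h <;> rw [h] <;> norm_num

theorem rowSign_mul_of_ne {r s : Fin 2} (h : r ≠ s) : rowSign r * rowSign s = -1 := by
  fin_cases r <;> fin_cases s <;> simp_all [rowSign]

theorem unit_sq (s : ℤˣ) : ((s : ℤ) : ℂ) * ((s : ℤ) : ℂ) = 1 := by
  rcases Int.units_eq_one_or s with rfl | rfl <;> norm_num

omit [FarCols C] in
theorem ladderModel_right (hpq : q.1 = p.1 + 1) :
    ladderModel g h o p q = rowSign p.2 * g p.1 := by
  simp [ladderModel, hpq]

theorem ladderModel_left (hpq : q.1 = p.1 + 1) :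
    ladderModel g h o q p = rowSign p.2 * (starRingEnd ℂ) (g p.1) := by
  have : p.1 ≠ p.1 + 1 + 1 := fun h1 => FarCols.two (C := C) (by linear_combination -h1)
  simp [ladderModel, hpq, this]

theorem ladderModel_same (hpq : p.1 = q.1) :
    ladderModel g h o p q = if p.2 = q.2 then h p.1 else o p.1 := by
  have h2 : q.1 ≠ q.1 + 1 := fun h1 => FarCols.one (C := C) (by linear_combination -h1)
  have h3 : ¬q.1 = p.1 + 1 := hpq ▸ h2
  have h4 : ¬p.1 = q.1 + 1 := hpq ▸ h2
  rw [ladderModel, if_neg h3, if_neg h4, if_pos hpq]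

theorem ladderModel_isHermitian_apply (hh : ∀ c, (starRingEnd ℂ) (h c) = h c)
    (ho : ∀ c, (starRingEnd ℂ) (o c) = o c) (p q : C × Fin 2) :
    (starRingEnd ℂ) (ladderModel g h o q p) = ladderModel g h o p q := by
  have hr : ∀ r, (starRingEnd ℂ) (rowSign r) = rowSign r := fun r => by
    unfold rowSign; split_ifs <;> simp
  by_cases h1 : q.1 = p.1 + 1
  · rw [ladderModel_right h1, ladderModel_left h1, map_mul, hr, Complex.conj_conj]
  by_cases h2 : p.1 = q.1 + 1
  · rw [ladderModel_right h2, ladderModel_left h2, map_mul, hr]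
  by_cases h3 : p.1 = q.1
  · rw [ladderModel_same h3, ladderModel_same h3.symm, h3]
    by_cases h4 : p.2 = q.2
    · rw [if_pos h4, if_pos h4.symm, hh]
    · rw [if_neg h4, if_neg (Ne.symm h4), ho]
  · simp [ladderModel, h1, h2, h3, Ne.symm h3]

variable {V : Type*} {A : Matrix V V ℂ} {S : Finset V}

omit [FarCols C] in
theorem LadderLabels.mono {P Q : Set (C × Fin 2)} (H : LadderLabels ω g h o Q) (hPQ : P ⊆ Q) :
    LadderLabels ω g h o P where
  edge := H.edge
  charge := H.charge
  ends p hp := (H.ends p (hPQ hp)).imp_right (Or.imp (And.imp_right fun h1 q hq => h1 q (hPQ hq))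
    (And.imp_right fun h1 q hq => h1 q (hPQ hq)))
  heavy p hp q hq hpq hg := (H.heavy p (hPQ hp) q (hPQ hq) hpq hg).imp
    (And.imp_right fun h1 r hr => h1 r (hPQ hr)) (And.imp_right fun h1 r hr => h1 r (hPQ hr))

/-- A graph that is obtained by switching from a part of the universal ladder has a column
structure. -/
theorem colStr_of_ladderModel {Φ : V → C × Fin 2} (hΦ : Set.InjOn Φ S) (σ : V → ℤˣ)
    (hA : ∀ x ∈ S, ∀ y ∈ S,
      A x y = ((σ x : ℤ) : ℂ) * ladderModel g h o (Φ x) (Φ y) * ((σ y : ℤ) : ℂ))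
    (H : LadderLabels ω g h o (Φ '' S)) : ColStr ω A S fun x => (Φ x).1 := by
  set U : V → V → ℂ := fun x y => ladderModel g h o (Φ x) (Φ y) with hU
  have img : ∀ {x}, x ∈ S → Φ x ∈ Φ '' S := fun hx => Set.mem_image_of_mem Φ hx
  have diag : ∀ x ∈ S, A x x = h (Φ x).1 := fun x hx => by
    rw [hA x hx x hx, ladderModel_same rfl, if_pos rfl]
    linear_combination h (Φ x).1 * unit_sq (σ x)
  have row : ∀ {x y}, x ∈ S → y ∈ S → x ≠ y → (Φ x).1 = (Φ y).1 → (Φ x).2 ≠ (Φ y).2 :=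
    fun hx hy hxy h1 h2 => hxy (hΦ hx hy (Prod.ext h1 h2))
  have quad : ∀ x ∈ S, ∀ y ∈ S, ∀ p ∈ S, ∀ q ∈ S,
      A x p * A p y * (A y q * A q x) = U x p * U p y * (U y q * U q x) := by
    intro x hx y hy p hp q hq
    rw [hA x hx p hp, hA p hp y hy, hA y hy q hq, hA q hq x hx]
    calc _ = (((σ x : ℤ) : ℂ) * (σ x : ℤ)) * (((σ y : ℤ) : ℂ) * (σ y : ℤ)) *
          (((σ p : ℤ) : ℂ) * (σ p : ℤ)) * (((σ q : ℤ) : ℂ) * (σ q : ℤ)) *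
          (U x p * U p y * (U y q * U q x)) := by ring
      _ = _ := by simp only [unit_sq, one_mul]
  have pair : ∀ x ∈ S, ∀ p ∈ S, A x p * A p x = U x p * U p x := by
    intro x hx p hp
    rw [hA x hx p hp, hA p hp x hx]
    calc _ = (((σ x : ℤ) : ℂ) * (σ x : ℤ)) * (((σ p : ℤ) : ℂ) * (σ p : ℤ)) *
          (U x p * U p x) := by ring
      _ = _ := by simp only [unit_sq, one_mul]
  have tri : ∀ x ∈ S, ∀ y ∈ S, ∀ p ∈ S, A x y * A y p * A p x = U x y * U y p * U p x := by
    intro x hx y hy p hp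
    rw [hA x hx y hy, hA y hy p hp, hA p hp x hx]
    calc _ = (((σ x : ℤ) : ℂ) * (σ x : ℤ)) * (((σ y : ℤ) : ℂ) * (σ y : ℤ)) *
          (((σ p : ℤ) : ℂ) * (σ p : ℤ)) * (U x y * U y p * U p x) := by ring
      _ = _ := by simp only [unit_sq, one_mul]
  -- Paths of length two between two vertices of a column, through the right or the left.
  have right : ∀ {x y p}, (Φ x).1 = (Φ y).1 → (Φ p).1 = (Φ x).1 + 1 → U x p * U p y =
      rowSign (Φ x).2 * rowSign (Φ y).2 * (g (Φ x).1 * (starRingEnd ℂ) (g (Φ x).1)) := by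
    intro x y p hxy hp
    simp only [hU]
    rw [ladderModel_right hp, ladderModel_left (hp.trans (by rw [hxy])), hxy]
    ring
  have left : ∀ {x y p}, (Φ x).1 = (Φ y).1 → (Φ x).1 = (Φ p).1 + 1 → U x p * U p y =
      g (Φ p).1 * (starRingEnd ℂ) (g (Φ p).1) := by
    intro x y p hxy hp
    simp only [hU]
    rw [ladderModel_left hp, ladderModel_right (hxy.symm.trans hp)]
    linear_combination g (Φ p).1 * (starRingEnd ℂ) (g (Φ p).1) * rowSign_sq (Φ p).2
  have gnorm : ∀ {x y}, x ∈ S → y ∈ S → (Φ y).1 = (Φ x).1 + 1 → A x y * A y x =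
      g (Φ x).1 * (starRingEnd ℂ) (g (Φ x).1) := by
    intro x y hx hy hxy
    rw [pair x hx y hy, right rfl hxy, rowSign_sq, one_mul]
  have nb : ∀ {a b : C}, Nb a b ↔ b = a + 1 ∨ a = b + 1 := Iff.rfl
  have ends : ∀ {x p q}, x ∈ S → p ∈ S → q ∈ S → A x x ≠ 0 → (Φ p).1 = (Φ x).1 + 1 →
      (Φ x).1 = (Φ q).1 + 1 → False := by
    intro x p q hx hp hq h0 hxp hxq
    rw [diag x hx] at h0
    rcases H.ends _ (img hx) with h1 | h1 | h1
    exacts [h0 h1.1, h1.2 _ (img hq) hxq, h1.2 _ (img hp) hxp]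
  have heavy : ∀ x ∈ S, ∀ y ∈ S, (Φ y).1 = (Φ x).1 + 1 → A x y * A y x ≠ 1 →
      (A x x = 0 ∧ ∀ z ∈ S, ((Φ z).1 = (Φ x).1 → z = x) ∧
        (Nb (Φ x).1 (Φ z).1 → (Φ z).1 = (Φ y).1)) ∨
      (A y y = 0 ∧ ∀ z ∈ S, ((Φ z).1 = (Φ y).1 → z = y) ∧
        (Nb (Φ y).1 (Φ z).1 → (Φ z).1 = (Φ x).1)) := by
    intro x hx y hy hxy hne
    rw [gnorm hx hy hxy] at hne
    rw [diag x hx, diag y hy]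
    refine (H.heavy _ (img hx) _ (img hy) hxy hne).imp (And.imp_right fun h1 z hz => ?_)
      (And.imp_right fun h1 z hz => ?_)
    · obtain ⟨h2, h3⟩ := h1 _ (img hz)
      exact ⟨fun h4 => hΦ hz hx (h2 h4), fun h4 => (h4.resolve_right h3).trans hxy.symm⟩
    · obtain ⟨h2, h3⟩ := h1 _ (img hz)
      exact ⟨fun h4 => hΦ hz hy (h2 h4), fun h4 =>
        add_right_cancel ((h4.resolve_left h3).symm.trans hxy)⟩
  refine ⟨?_, ?_, ?_, ?_, ?_, ?_, ?_, ?_, ?_, ?_⟩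
  · intro x hx y hy h0
    by_contra hcon
    rw [not_or, nb, not_or] at hcon
    apply h0
    rw [hA x hx y hy, ladderModel, if_neg hcon.2.1, if_neg hcon.2.2, if_neg hcon.1]
    simp
  · have aux : ∀ (z : ℂ) (r : Fin 2), z ∈ edgeLabels ω → rowSign r * z ∈ edgeLabels ω := by
      intro z r hz
      rcases rowSign_eq r with h1 | h1 <;> rw [h1]
      · simpa using hz
      · simpa using edgeLabels_neg hz
    intro x hx y hy hxy
    rw [hA x hx y hy, mul_comm]
    refine edgeLabels_unit_mul _ (edgeLabels_unit_mul _ ?_)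
    rcases hxy with hxy | hxy
    · rw [ladderModel_right hxy]
      exact aux _ _ (H.edge _)
    · rw [ladderModel_left hxy]
      exact aux _ _ (edgeLabels_conj (H.edge _))
  · intro x hx y hy z hz hxy hxz
    by_contra! hcon
    have h1 := row hx hy hcon.1 hxy
    have h2 := row hx hz hcon.2.1 hxz
    have h3 := row hy hz hcon.2.2 (hxy.symm.trans hxz)
    omega
  · intro x hx
    rw [diag x hx]
    exact H.charge _
  · intro x hx y hy p hp q hq hxy hpq hxp
    rw [quad x hx y hy p hp q hq, pair x hx p hp, pair x hx q hq]
    rcases hxp with hxp | hxp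
    · have hxq := hpq.symm.trans hxp
      rw [right hxy hxp, right hxy.symm (hxq.trans (by rw [hxy])), right rfl hxp, right rfl hxq,
        ← hxy]
      have h1 := rowSign_sq (Φ x).2
      have h2 := rowSign_sq (Φ y).2
      linear_combination (g (Φ x).1 * (starRingEnd ℂ) (g (Φ x).1)) ^ 2 *
        (rowSign (Φ x).2 * rowSign (Φ x).2 * h2 - rowSign (Φ x).2 * rowSign (Φ x).2 * h1)
    · have hxq : (Φ x).1 = (Φ q).1 + 1 := hxp.trans (by rw [hpq])
      rw [left hxy hxp, left hxy.symm (hxy.symm.trans hxq), left rfl hxp, left rfl hxq]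
  · -- Reduction to the case of `p` on the left and `q` on the right.
    have key : ∀ x ∈ S, ∀ y ∈ S, ∀ p ∈ S, ∀ q ∈ S, x ≠ y → (Φ x).1 = (Φ y).1 →
        (Φ x).1 = (Φ p).1 + 1 → (Φ q).1 = (Φ x).1 + 1 →
        A x p * A p y * (A y q * A q x) = -(A x p * A p x * (A x q * A q x)) := by
      intro x hx y hy p hp q hq hne hxy hxp hxq
      rw [quad x hx y hy p hp q hq, pair x hx p hp, pair x hx q hq, left hxy hxp,
        right hxy.symm (hxq.trans (by rw [hxy])), left rfl hxp, right rfl hxq,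
        rowSign_mul_of_ne (row hy hx hne.symm hxy.symm), rowSign_sq, ← hxy]
      ring
    intro x hx y hy p hp q hq hne hxy hpq hxp hxq
    rcases hxp with hxp | hxp <;> rcases hxq with hxq | hxq
    · exact absurd (hxp.trans hxq.symm) hpq
    · have h1 := key y hy x hx q hq p hp hne.symm hxy.symm (hxy.symm.trans hxq)
        (hxp.trans (by rw [hxy]))
      have h2 := quad x hx y hy p hp q hq
      have h3 := quad y hy x hx q hq p hp
      have h4 : A y q * A q y = A x q * A q x := by
        rw [pair y hy q hq, pair x hx q hq, left rfl (hxy.symm.trans hxq), left rfl hxq]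
      have h5 : A y p * A p y = A x p * A p x := by
        rw [pair y hy p hp, pair x hx p hp, right rfl (hxp.trans (by rw [hxy])), right rfl hxp,
          rowSign_sq, rowSign_sq, hxy]
      rw [h4, h5] at h1
      linear_combination h1
    · exact key x hx y hy p hp q hq hne hxy hxp hxq
    · exact absurd (add_right_cancel (hxp.symm.trans hxq)) hpq
  · have sgn : ∀ (s t a b : ℂ), (s = 1 ∨ s = -1) → (t = 1 ∨ t = -1) → (a = 1 ∨ a = -1) →
        (b = 1 ∨ b = -1) → ∀ z w : ℂ, s * (a * z) * w = t * (b * z) * w ∨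
          s * (a * z) * w = -(t * (b * z) * w) := by
      rintro s t a b (rfl | rfl) (rfl | rfl) (rfl | rfl) (rfl | rfl) z w <;> simp
    have unit : ∀ s : ℤˣ, ((s : ℤ) : ℂ) = 1 ∨ ((s : ℤ) : ℂ) = -1 := fun s => by
      rcases Int.units_eq_one_or s with rfl | rfl <;> simp
    intro x hx y hy p hp hxy hxp
    rw [hA x hx p hp, hA y hy p hp]
    rcases hxp with hxp | hxp
    · rw [ladderModel_right hxp, ladderModel_right (hxp.trans (by rw [hxy])), ← hxy]
      exact sgn _ _ _ _ (unit _) (unit _) (rowSign_eq _) (rowSign_eq _) _ _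
    · rw [ladderModel_left hxp, ladderModel_left (hxy.symm.trans hxp)]
      exact sgn _ _ _ _ (unit _) (unit _) (rowSign_eq _) (rowSign_eq _) _ _
  · intro x hx y hy p hp hne hxy hxp
    have hr := row hx hy hne hxy
    rw [tri x hx y hy p hp, pair x hx p hp, diag x hx, mul_assoc]
    have hU' : U x y = o (Φ x).1 := by
      simp only [hU]
      rw [ladderModel_same hxy, if_neg hr]
    rw [hU']
    rcases hxp with hxp | hxp
    · rw [right hxy.symm (hxp.trans (by rw [hxy])), right rfl hxp, rowSign_sq,
        rowSign_mul_of_ne hr.symm, ← hxy]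
      rcases H.ends _ (img hx) with h1 | h1 | h1
      · rw [h1.1, h1.2]; ring
      · rw [h1.1]; ring
      · exact absurd hxp (h1.2 _ (img hp))
    · rw [left hxy.symm (hxy.symm.trans hxp), left rfl hxp]
      rcases H.ends _ (img hx) with h1 | h1 | h1
      · rw [h1.1, h1.2]; ring
      · exact absurd hxp (h1.2 _ (img hp))
      · rw [h1.1]; ring
  · intro x hx p hp q hq h0 hxp hxq
    rcases hxp with hxp | hxp <;> rcases hxq with hxq | hxq
    · exact hxp.trans hxq.symm
    · exact (ends hx hp hq h0 hxp hxq).elim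
    · exact (ends hx hq hp h0 hxq hxp).elim
    · exact add_right_cancel (hxp.symm.trans hxq)
  · intro x hx y hy hxy hne
    rcases hxy with hxy | hxy
    · exact heavy x hx y hy hxy hne
    · exact (heavy y hy x hx hxy (by rwa [mul_comm])).symm

end Model

/-! ### The families as parts of universal ladders -/

section Families

variable {V W : Type*} {A : Matrix V V ℂ} {B : Matrix W W ℂ} {d : ℤ} {ω : ℂ}

theorem equivToSubgraph_iff : EquivToSubgraph A B ↔
    ∃ (f : V → W) (σ : V → ℤˣ) (ε : ℤˣ) (θ : ℂ →+* ℂ),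
      (θ = RingHom.id ℂ ∨ θ = starRingEnd ℂ) ∧ Function.Injective f ∧
      ∀ i j, A i j = ((σ i : ℤ) : ℂ) * (((ε : ℤ) : ℂ) * θ (B (f i) (f j))) * ((σ j : ℤ) : ℂ) := by
  constructor
  · rintro ⟨S, ⟨e, σ, h⟩ | ⟨e, σ, h⟩ | ⟨e, σ, h⟩ | ⟨e, σ, h⟩⟩
    · exact ⟨fun i => (e i : W), σ, 1, RingHom.id ℂ, Or.inl rfl,
        Subtype.val_injective.comp e.injective, fun i j => by simp [h, inducedSub]⟩
    · exact ⟨fun i => (e i : W), σ, -1, RingHom.id ℂ, Or.inl rfl,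
        Subtype.val_injective.comp e.injective, fun i j => by simp [h, inducedSub]⟩
    · exact ⟨fun i => (e i : W), σ, 1, starRingEnd ℂ, Or.inr rfl,
        Subtype.val_injective.comp e.injective, fun i j => by simp [h, inducedSub]⟩
    · exact ⟨fun i => (e i : W), σ, -1, starRingEnd ℂ, Or.inr rfl,
        Subtype.val_injective.comp e.injective, fun i j => by simp [h, inducedSub]⟩
  · rintro ⟨f, σ, ε, θ, hθ, hf, h⟩
    refine ⟨Set.range f, ?_⟩
    rcases hθ with rfl | rfl <;> rcases Int.units_eq_one_or ε with rfl | rfl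
    · exact Or.inl ⟨Equiv.ofInjective f hf, σ, fun i j => by simp [h, inducedSub]⟩
    · exact Or.inr (Or.inl ⟨Equiv.ofInjective f hf, σ, fun i j => by simp [h, inducedSub]⟩)
    · exact Or.inr (Or.inr (Or.inl
        ⟨Equiv.ofInjective f hf, σ, fun i j => by simp [h, inducedSub]⟩))
    · exact Or.inr (Or.inr (Or.inr
        ⟨Equiv.ofInjective f hf, σ, fun i j => by simp [h, inducedSub]⟩))

variable {C : Type*} [CommRing C] {g h o : C → ℂ} {ψ : W → C × Fin 2}

theorem equivToSubgraph_of_model (hB : ∀ p q, B p q = ladderModel g h o (ψ p) (ψ q))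
    {Φ : V → C × Fin 2} (hΦ : Function.Injective Φ) (hr : ∀ x, Φ x ∈ Set.range ψ) (σ : V → ℤˣ)
    (hA : ∀ x y, A x y = ((σ x : ℤ) : ℂ) * ladderModel g h o (Φ x) (Φ y) * ((σ y : ℤ) : ℂ)) :
    EquivToSubgraph A B := by
  choose f hf using hr
  refine equivToSubgraph_iff.2 ⟨f, σ, 1, RingHom.id ℂ, Or.inl rfl, fun x y hxy => hΦ ?_, ?_⟩
  · rw [← hf x, ← hf y, hxy]
  · intro i j
    rw [hA, hB, hf, hf]
    simp

theorem exists_colStr_of_equiv [FarCols C] {S : Finset V}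
    (hB : ∀ p q, B p q = ladderModel g h o (ψ p) (ψ q)) (hψ : Function.Injective ψ)
    (H : LadderLabels ω g h o (Set.range ψ)) (hh : ∀ c, (starRingEnd ℂ) (h c) = h c)
    (ho : ∀ c, (starRingEnd ℂ) (o c) = o c)
    (hAB : EquivToSubgraph (inducedSub A (S : Set V)) B) :
    ∃ col : V → C, ColStr ω A S col := by
  classical
  obtain ⟨f, σ, ε, θ, hθ, hf, hA⟩ := equivToSubgraph_iff.1 hAB
  set g' : C → ℂ := fun c => ((ε : ℤ) : ℂ) * θ (g c) with hg'
  set h' : C → ℂ := fun c => ((ε : ℤ) : ℂ) * h c with hh'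
  set o' : C → ℂ := fun c => ((ε : ℤ) : ℂ) * o c with ho'
  have θr : ∀ r, θ (rowSign r) = rowSign r := fun r => by
    unfold rowSign; split_ifs <;> simp
  have θc : ∀ z, θ ((starRingEnd ℂ) z) = (starRingEnd ℂ) (θ z) := fun z => by
    rcases hθ with rfl | rfl <;> simp
  have θh : ∀ c, θ (h c) = h c := fun c => by rcases hθ with rfl | rfl <;> simp [hh]
  have θo : ∀ c, θ (o c) = o c := fun c => by rcases hθ with rfl | rfl <;> simp [ho]
  have θn : ∀ c, g' c * (starRingEnd ℂ) (g' c) = θ (g c * (starRingEnd ℂ) (g c)) := fun c => by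
    rw [hg', map_mul, map_mul, θc, map_intCast]
    linear_combination θ (g c) * (starRingEnd ℂ) (θ (g c)) * unit_sq ε
  have hmodel : ∀ p q, ladderModel g' h' o' p q =
      ((ε : ℤ) : ℂ) * θ (ladderModel g h o p q) := by
    intro p q
    unfold ladderModel
    split_ifs
    · rw [map_mul, θr]; ring
    · simp only [hg', map_mul, θr, θc, map_intCast]; ring
    · rw [θh]
    · rw [θo]
    · simp
  have H' : LadderLabels ω g' h' o' (Set.range ψ) := by
    refine ⟨fun c => edgeLabels_unit_mul ε ?_, fun c => ?_, fun p hp => ?_, ?_⟩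
    · rcases hθ with rfl | rfl
      · exact H.edge c
      · exact edgeLabels_conj (H.edge c)
    · rcases H.charge c with h1 | h1 | h1 <;> rcases Int.units_eq_one_or ε with rfl | rfl <;>
        simp [hh', h1]
    · rcases H.ends p hp with h1 | h1 | h1
      · exact Or.inl (by simp [hh', ho', h1])
      · exact Or.inr (Or.inl ⟨by simp [hh', ho', h1.1], h1.2⟩)
      · exact Or.inr (Or.inr ⟨by simp [hh', ho', h1.1], h1.2⟩)
    · intro p hp q hq hpq hg
      rw [θn] at hg
      refine (H.heavy p hp q hq hpq fun h1 => hg (by rw [h1, map_one])).imp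
        (And.imp_left fun h1 => ?_) (And.imp_left fun h1 => ?_) <;> simp [hh', h1]
  set Φ : V → C × Fin 2 := fun x => if hx : x ∈ S then ψ (f ⟨x, hx⟩) else (0, 0) with hΦ
  have Φeq : ∀ x (hx : x ∈ S), Φ x = ψ (f ⟨x, hx⟩) := fun x hx => by simp [hΦ, hx]
  refine ⟨fun x => (Φ x).1, colStr_of_ladderModel (g := g') (h := h') (o := o')
    (Φ := Φ) ?_ (fun x => if hx : x ∈ S then σ ⟨x, hx⟩ else 1) ?_ (H'.mono ?_)⟩
  · intro x hx y hy hxy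
    rw [Φeq x hx, Φeq y hy] at hxy
    exact congrArg Subtype.val (hf (hψ hxy))
  · intro x hx y hy
    have := hA ⟨x, hx⟩ ⟨y, hy⟩
    rw [Φeq x hx, Φeq y hy, dif_pos hx, dif_pos hy, hmodel, ← hB]
    exact this
  · rintro _ ⟨x, hx, rfl⟩
    rw [Φeq x hx]
    exact Set.mem_range_self _

/-! #### The toroidal graphs -/

theorem graphT_eq_model {k : ℕ} (p q : LadderVertex k) :
    graphT k p q = ladderModel (C := ZMod k) (fun _ => 1) (fun _ => 0) (fun _ => 0)
      (((p.1 : ℕ) : ZMod k), p.2) (((q.1 : ℕ) : ZMod k), q.2) := by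
  have key : ∀ a b : Fin k, (b : ℕ) = ((a : ℕ) + 1) % k ↔
      (((b : ℕ) : ZMod k) = ((a : ℕ) : ZMod k) + 1) := by
    intro a b
    have h1 : ((a : ℕ) : ZMod k) + 1 = (((a : ℕ) + 1 : ℕ) : ZMod k) := by push_cast; rfl
    rw [h1, ZMod.natCast_eq_natCast_iff', Nat.mod_eq_of_lt b.2]
  simp only [graphT, Matrix.of_apply, ladderModel, key, map_one, mul_one, ite_self]

theorem graphT_index_injective {k : ℕ} :
    Function.Injective fun p : LadderVertex k => (((p.1 : ℕ) : ZMod k), p.2) := by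
  rintro ⟨a, r⟩ ⟨b, s⟩ h
  simp only [Prod.mk.injEq, ZMod.natCast_eq_natCast_iff', Nat.mod_eq_of_lt a.2,
    Nat.mod_eq_of_lt b.2] at h
  exact Prod.ext (Fin.ext h.1) h.2

/-! #### The graphs with two charged ends -/

/-- The charges in the columns of `C_{2k}^{++}` and `C_{2k}^{+-}`. -/
noncomputable def chargeC (ε : ℤˣ) (k : ℕ) (c : ℤ) : ℂ :=
  if c = 0 then 1 else if c + 1 = k then ((ε : ℤ) : ℂ) else 0

/-- The edge labels inside the columns of `C_{2k}^{++}` and `C_{2k}^{+-}`. -/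
noncomputable def innerC (ε : ℤˣ) (k : ℕ) (c : ℤ) : ℂ :=
  if c = 0 then 1 else if c + 1 = k then -((ε : ℤ) : ℂ) else 0

theorem graphC_eq_model (ε : ℤˣ) (k : ℕ) (p q : LadderVertex k) :
    graphC ε k p q = ladderModel (C := ℤ) (fun _ => 1) (chargeC ε k) (innerC ε k)
      (((p.1 : ℕ) : ℤ), p.2) (((q.1 : ℕ) : ℤ), q.2) := by
  have key : ∀ a b : Fin k, ((b : ℕ) : ℤ) = ((a : ℕ) : ℤ) + 1 ↔ (b : ℕ) = a + 1 := by omega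
  have key2 : ∀ a : Fin k, ((a : ℕ) : ℤ) + 1 = k ↔ (a : ℕ) + 1 = k := by omega
  simp only [graphC, Matrix.of_apply, ladderModel, ladderEdge, chargeC, innerC, key, key2,
    Nat.cast_inj, Nat.cast_eq_zero, Fin.ext_iff, map_one, mul_one]
  split_ifs <;> first | rfl | omega

theorem ladder_index_injective {k : ℕ} :
    Function.Injective fun p : LadderVertex k => (((p.1 : ℕ) : ℤ), p.2) := by
  rintro ⟨a, r⟩ ⟨b, s⟩ h
  simp only [Prod.mk.injEq, Nat.cast_inj] at h
  exact Prod.ext (Fin.ext h.1) h.2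

theorem mem_range_ladder_index {k : ℕ} {p : ℤ × Fin 2} :
    p ∈ Set.range (fun p : LadderVertex k => (((p.1 : ℕ) : ℤ), p.2)) ↔ 0 ≤ p.1 ∧ p.1 < k := by
  constructor
  · rintro ⟨⟨a, r⟩, rfl⟩
    have := a.2
    simp
  · rintro ⟨h1, h2⟩
    exact ⟨(⟨p.1.toNat, by omega⟩, p.2), Prod.ext (by simp [h1]) rfl⟩

theorem ladderLabels_graphC (ε : ℤˣ) (k : ℕ) :
    LadderLabels ω (fun _ => 1) (chargeC ε k) (innerC ε k)
      (Set.range fun p : LadderVertex k => (((p.1 : ℕ) : ℤ), p.2)) := by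
  refine ⟨fun _ => by simp [edgeLabels], fun c => ?_, fun p hp => ?_, fun p _ q _ _ h => ?_⟩
  · unfold chargeC
    rcases Int.units_eq_one_or ε with rfl | rfl <;> split_ifs <;> simp
  · unfold chargeC innerC
    simp only [mem_range_ladder_index] at hp ⊢
    split_ifs with h1 h2
    · exact Or.inr (Or.inl ⟨rfl, fun q hq => by omega⟩)
    · exact Or.inr (Or.inr ⟨rfl, fun q hq => by omega⟩)
    · exact Or.inl ⟨rfl, rfl⟩
  · simp at h

/-! #### The graphs with one charged end -/

/-- The positions of the vertices of `C_{2k}^{2+}` in the universal ladder. -/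
def indexC2 (k : ℕ) : LadderVertex k ⊕ Unit → ℤ × Fin 2
  | .inl p => (((p.1 : ℕ) : ℤ), p.2)
  | .inr _ => ((k : ℤ), 0)

/-- The labels between the columns of `C_{2k}^{2+}`. -/
noncomputable def edgeC2 (ω : ℂ) (k : ℕ) (c : ℤ) : ℂ := if c + 1 = k then ω else 1

theorem graphC2_eq_model (d : ℤ) {k : ℕ} (hk : 1 ≤ k) (p q : LadderVertex k ⊕ Unit) :
    graphC2 d k p q = ladderModel (edgeC2 (omegaLabel d) k) (fun c => if c = 0 then 1 else 0)
      (fun c => if c = 0 then 1 else 0) (indexC2 k p) (indexC2 k q) := by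
  have key : ∀ a b : Fin k, ((b : ℕ) : ℤ) = ((a : ℕ) : ℤ) + 1 ↔ (b : ℕ) = a + 1 := by omega
  have key2 : ∀ a : Fin k, (k : ℤ) = ((a : ℕ) : ℤ) + 1 ↔ (a : ℕ) + 1 = k := by omega
  have key3 : ∀ a : Fin k, ((a : ℕ) : ℤ) + 1 = k ↔ (a : ℕ) + 1 = k := by omega
  have key4 : ∀ a : Fin k, ¬((a : ℕ) : ℤ) = k + 1 := by omega
  have key5 : ∀ a : Fin k, ¬((a : ℕ) : ℤ) = k := by omega
  have key6 : ∀ a : Fin k, ¬(k : ℤ) = ((a : ℕ) : ℤ) := by omega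
  have hr : ∀ r, (starRingEnd ℂ) (rowSign r) = rowSign r := fun r => by
    unfold rowSign; split_ifs <;> simp
  rcases p with ⟨a, r⟩ | _ <;> rcases q with ⟨b, s⟩ | _
  · simp only [graphC2, Matrix.of_apply, ladderModel, ladderEdge, indexC2, edgeC2, key, key3,
      Nat.cast_inj, Nat.cast_eq_zero, Fin.ext_iff]
    split_ifs <;> first | rfl | omega | simp
  · simp only [graphC2, Matrix.of_apply, ladderModel, indexC2, edgeC2, key2, key3, key4, key5]
    split_ifs <;> first | rfl | omega | contradiction
  · simp only [graphC2, Matrix.of_apply, ladderModel, indexC2, edgeC2, key2, key3, key4, key6,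
      map_mul, hr]
    split_ifs <;> first | rfl | omega | simp_all
  · simp only [graphC2, Matrix.of_apply, ladderModel, indexC2]
    split_ifs <;> first | rfl | omega | exact (if_neg ‹_›).symm

theorem indexC2_injective (k : ℕ) : Function.Injective (indexC2 k) := by
  rintro (p | _) (q | _) h
  · exact congrArg _ (ladder_index_injective h)
  · have := p.1.2
    have h1 := (Prod.ext_iff.1 h).1
    simp only [indexC2] at h1
    omega
  · have := q.1.2
    have h1 := (Prod.ext_iff.1 h).1
    simp only [indexC2] at h1
    omega
  · rfl

theorem mem_range_indexC2 {k : ℕ} {p : ℤ × Fin 2} :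
    p ∈ Set.range (indexC2 k) ↔ (0 ≤ p.1 ∧ p.1 < k) ∨ p = ((k : ℤ), 0) := by
  rw [← mem_range_ladder_index (k := k)]
  constructor
  · rintro ⟨q | _, rfl⟩
    exacts [Or.inl ⟨q, rfl⟩, Or.inr rfl]
  · rintro (⟨q, rfl⟩ | rfl)
    exacts [⟨.inl q, rfl⟩, ⟨.inr (), rfl⟩]

theorem ladderLabels_graphC2 {k : ℕ} (hk : 1 ≤ k) :
    LadderLabels ω (edgeC2 ω k) (fun c => if c = 0 then 1 else 0)
      (fun c => if c = 0 then 1 else 0) (Set.range (indexC2 k)) := by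
  have hcol : ∀ p ∈ Set.range (indexC2 k), 0 ≤ p.1 ∧ p.1 ≤ k ∧ (p.1 = k → p.2 = 0) := by
    intro p hp
    rcases mem_range_indexC2.1 hp with h | rfl
    · exact ⟨h.1, h.2.le, fun h1 => by omega⟩
    · simp
  refine ⟨fun c => ?_, fun c => ?_, fun p hp => ?_, fun p hp q hq hpq hg => ?_⟩
  · unfold edgeC2
    split_ifs <;> simp [edgeLabels]
  · split_ifs <;> simp
  · split_ifs with h1
    · exact Or.inr (Or.inl ⟨rfl, fun q hq => by have := hcol q hq; omega⟩)
    · exact Or.inl ⟨rfl, rfl⟩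
  · have hpk : p.1 + 1 = k := by
      by_contra h1
      simp [edgeC2, h1] at hg
    refine Or.inr ⟨if_neg (by omega), fun r hr => ⟨fun h1 => ?_, ?_⟩⟩
    · have h2 := hcol r hr
      have h3 := hcol q hq
      exact Prod.ext h1 ((h2.2.2 (by omega)).trans (h3.2.2 (by omega)).symm)
    · have h2 := hcol r hr
      omega

/-! #### The graphs with two ends of weight two -/

/-- The positions of the vertices of `T_{2k}^4` and `T_{2k}^4'` in the universal ladder. -/
def indexT4 (k : ℕ) : LadderVertex (k - 1) ⊕ Fin 2 → ℤ × Fin 2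
  | .inl p => (((p.1 : ℕ) : ℤ) + 1, p.2)
  | .inr t => (if t = 0 then 0 else (k : ℤ), 0)

/-- The labels between the columns of `T_{2k}^4` and `T_{2k}^4'`. -/
noncomputable def edgeT4 (ω η : ℂ) (k : ℕ) (c : ℤ) : ℂ :=
  if c = 0 then (starRingEnd ℂ) ω else if c + 1 = k then η else 1

theorem graphT4Aux_eq_model (ω η : ℂ) {k : ℕ} (hk : 2 ≤ k)
    (p q : LadderVertex (k - 1) ⊕ Fin 2) :
    graphT4Aux ω η k p q = ladderModel (edgeT4 ω η k) (fun _ => 0) (fun _ => 0)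
      (indexT4 k p) (indexT4 k q) := by
  have hr : ∀ r, (starRingEnd ℂ) (rowSign r) = rowSign r := fun r => by
    unfold rowSign; split_ifs <;> simp
  -- Columns of the ladder are shifted by one, to make room for the left end.
  have key : ∀ a b : Fin (k - 1), ((b : ℕ) : ℤ) + 1 = ((a : ℕ) : ℤ) + 1 + 1 ↔ (b : ℕ) = a + 1 := by
    omega
  rcases p with ⟨a, r⟩ | t <;> rcases q with ⟨b, s⟩ | u
  · have k1 : ∀ a : Fin (k - 1), ¬((a : ℕ) : ℤ) + 1 = 0 := by omega
    simp only [graphT4Aux, Matrix.of_apply, ladderModel, ladderEdge, indexT4, edgeT4, key, k1,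
      if_false]
    split_ifs <;> first | rfl | omega | (simp [*]; done) | (simp [*]; exact (ite_self _).symm)
  · have ha := a.2
    fin_cases u
    · have k1 : ¬((0 : ℤ) = ((a : ℕ) : ℤ) + 1 + 1) := by omega
      have k3 : ¬(((a : ℕ) : ℤ) + 1 = 0) := by omega
      simp [graphT4Aux, endLabel, ladderModel, indexT4, edgeT4, k1, k3, rowSign]
    · have k1 : ((k : ℤ) = ((a : ℕ) : ℤ) + 1 + 1) ↔ (a : ℕ) + 1 = k - 1 := by omega
      have k2 : ¬(((a : ℕ) : ℤ) + 1 = k + 1) := by omega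
      have k3 : ¬(((a : ℕ) : ℤ) + 1 = 0) := by omega
      have k4 : (((a : ℕ) : ℤ) + 1 + 1 = k) ↔ (a : ℕ) + 1 = k - 1 := by omega
      simp only [graphT4Aux, endLabel, Matrix.of_apply, ladderModel, indexT4, edgeT4]
      simp only [Fin.mk_one, Fin.isValue, one_ne_zero, if_false, k1, k2, k3, k4]
      split_ifs <;> first | rfl | omega
  · have hb := b.2
    fin_cases t
    · have k1 : ¬((0 : ℤ) = ((b : ℕ) : ℤ) + 1 + 1) := by omega
      have k2 : (((b : ℕ) : ℤ) + 1 = 0 + 1) ↔ (b : ℕ) = 0 := by omega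
      have k3 : ¬((0 : ℤ) = ((b : ℕ) : ℤ) + 1) := by omega
      simp only [graphT4Aux, endLabel, Matrix.of_apply, ladderModel, indexT4, edgeT4]
      simp only [Fin.zero_eta, Fin.isValue, if_true, k1, k2, k3, if_false, rowSign, one_mul]
      split_ifs <;> simp
    · have k1 : ((k : ℤ) = ((b : ℕ) : ℤ) + 1 + 1) ↔ (b : ℕ) + 1 = k - 1 := by omega
      have k2 : ¬(((b : ℕ) : ℤ) + 1 = k + 1) := by omega
      have k3 : ¬((k : ℤ) = ((b : ℕ) : ℤ) + 1) := by omega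
      have k4 : (((b : ℕ) : ℤ) + 1 + 1 = k) ↔ (b : ℕ) + 1 = k - 1 := by omega
      have k5 : ¬(((b : ℕ) : ℤ) + 1 = 0) := by omega
      simp only [graphT4Aux, endLabel, Matrix.of_apply, ladderModel, indexT4, edgeT4]
      simp only [Fin.mk_one, Fin.isValue, one_ne_zero, if_false, k1, k2, k3, k4, k5]
      split_ifs <;> simp [hr]
  · have k1 : ¬((0 : ℤ) = k + 1) := by omega
    have k2 : ¬((k : ℤ) = 0 + 1) := by omega
    have k3 : ¬((0 : ℤ) = 0 + 1) := by omega
    have k4 : ¬((k : ℤ) = k + 1) := by omega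
    fin_cases t <;> fin_cases u <;>
      simp only [graphT4Aux, Matrix.of_apply, ladderModel, indexT4, Fin.zero_eta, Fin.mk_one,
        Fin.isValue, one_ne_zero, if_true, if_false, k1, k2, k3, k4, ite_self]

theorem indexT4_injective {k : ℕ} (hk : 2 ≤ k) : Function.Injective (indexT4 k) := by
  rintro (⟨a, r⟩ | t) (⟨b, s⟩ | u) h
  · simp only [indexT4, Prod.mk.injEq] at h
    exact congrArg _ (Prod.ext (Fin.ext (by simpa using h.1)) h.2)
  · have h1 := (Prod.ext_iff.1 h).1
    have := a.2
    simp only [indexT4] at h1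
    split_ifs at h1 <;> omega
  · have h1 := (Prod.ext_iff.1 h).1
    have := b.2
    simp only [indexT4] at h1
    split_ifs at h1 <;> omega
  · have h1 := (Prod.ext_iff.1 h).1
    simp only [indexT4] at h1
    refine congrArg _ ?_
    split_ifs at h1 <;> omega

theorem mem_range_indexT4 {k : ℕ} {p : ℤ × Fin 2} :
    p ∈ Set.range (indexT4 k) ↔ (1 ≤ p.1 ∧ p.1 < k) ∨ p = (0, 0) ∨ p = ((k : ℤ), 0) := by
  constructor
  · rintro ⟨⟨a, r⟩ | t, rfl⟩
    · have := a.2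
      exact Or.inl ⟨by simp [indexT4], by simp only [indexT4]; omega⟩
    · refine Or.inr ?_
      simp only [indexT4]
      split_ifs <;> simp
  · rintro (⟨h1, h2⟩ | rfl | rfl)
    · exact ⟨.inl (⟨p.1.toNat - 1, by omega⟩, p.2), Prod.ext (by simp only [indexT4]; omega) rfl⟩
    · exact ⟨.inr 0, by simp [indexT4]⟩
    · exact ⟨.inr 1, by simp [indexT4]⟩

theorem ladderLabels_graphT4 {η : ℂ} (hη : η ∈ edgeLabels ω) (k : ℕ) :
    LadderLabels ω (edgeT4 ω η k) (fun _ => 0) (fun _ => 0) (Set.range (indexT4 k)) := by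
  have hcol : ∀ p ∈ Set.range (indexT4 k),
      0 ≤ p.1 ∧ p.1 ≤ k ∧ (p.1 = k → p.2 = 0) ∧ (p.1 = 0 → p.2 = 0) := by
    intro p hp
    rcases mem_range_indexT4.1 hp with h | rfl | rfl
    · exact ⟨by omega, h.2.le, fun h1 => by omega, fun h1 => by omega⟩
    · simp
    · simp
  refine ⟨fun c => ?_, fun c => Or.inl rfl, fun p hp => Or.inl ⟨rfl, rfl⟩,
    fun p hp q hq hpq hg => ?_⟩
  · unfold edgeT4
    split_ifs
    exacts [by simp [edgeLabels], hη, by simp [edgeLabels]]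
  · have hpk : p.1 = 0 ∨ p.1 + 1 = k := by
      by_contra! h1
      simp [edgeT4, h1.1, h1.2] at hg
    rcases hpk with hpk | hpk
    · refine Or.inl ⟨rfl, fun r hr => ⟨fun h1 => ?_, ?_⟩⟩
      · exact Prod.ext h1 (((hcol r hr).2.2.2 (by omega)).trans ((hcol p hp).2.2.2 hpk).symm)
      · have h2 := hcol r hr
        omega
    · refine Or.inr ⟨rfl, fun r hr => ⟨fun h1 => ?_, ?_⟩⟩
      · exact Prod.ext h1
          (((hcol r hr).2.2.1 (by omega)).trans ((hcol q hq).2.2.1 (by omega)).symm)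
      · have h2 := hcol r hr
        omega

/-- The subgraphs of the families on at least nine vertices have column structures. The
toroidal graphs with three or four columns are excluded by their size. -/
theorem hasColStr_of_inFamilies {S : Finset V} (hcard : 9 ≤ S.card)
    (hS : InFamilies d (inducedSub A (S : Set V))) : HasColStr (omegaLabel d) A S := by
  have conj01 : ∀ c : ℤ, (starRingEnd ℂ) (if c = 0 then (1 : ℂ) else 0) =
      if c = 0 then (1 : ℂ) else 0 := fun c => by split_ifs <;> simp
  rcases hS with ⟨k, -, h⟩ | ⟨k, hk, ε, h⟩ | ⟨k, hk, h⟩ | ⟨-, k, hk, h⟩ | ⟨k, hk, h⟩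
  · right
    have hk5 : 5 ≤ k := by
      obtain ⟨f, -, -, -, -, hf, -⟩ := equivToSubgraph_iff.1 h
      have := Fintype.card_le_of_injective f hf
      simp only [Finset.coe_sort_coe, Fintype.card_coe, Fintype.card_prod, Fintype.card_fin]
        at this
      omega
    have := farCols_zmod (m := k) (by omega)
    exact ⟨k, hk5, exists_colStr_of_equiv graphT_eq_model graphT_index_injective
      ⟨fun _ => by simp [edgeLabels], fun _ => Or.inl rfl, fun _ _ => Or.inl ⟨rfl, rfl⟩,
        fun _ _ _ _ _ h1 => by simp at h1⟩ (fun _ => by simp) (fun _ => by simp) h⟩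
  · exact Or.inl (exists_colStr_of_equiv (graphC_eq_model ε k) ladder_index_injective
      (ladderLabels_graphC ε k) (fun c => by unfold chargeC; split_ifs <;> simp)
      (fun c => by unfold innerC; split_ifs <;> simp) h)
  · exact Or.inl (exists_colStr_of_equiv (graphT4Aux_eq_model _ _ hk) (indexT4_injective hk)
      (ladderLabels_graphT4 (by simp [edgeLabels]) k) (fun _ => by simp) (fun _ => by simp) h)
  · exact Or.inl (exists_colStr_of_equiv (graphT4Aux_eq_model _ _ hk) (indexT4_injective hk)
      (ladderLabels_graphT4 (by simp [edgeLabels]) k) (fun _ => by simp) (fun _ => by simp) h)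
  · exact Or.inl (exists_colStr_of_equiv (graphC2_eq_model d hk) (indexC2_injective k)
      (ladderLabels_graphC2 hk) conj01 conj01 h)

end Families

/-! ### Graphs with equal columns differ by switching -/

section Switch

variable {V : Type*} [Fintype V] {C : Type*} [CommRing C] {ω : ℂ}
  {A B : Matrix V V ℂ} {col : V → C}

theorem unit_eq_of_mul {a b c d s : ℤˣ} (h : a * b * (c * d) = 1) : d = s * a * (s * b) * c := by
  rcases Int.units_eq_one_or a with rfl | rfl <;> rcases Int.units_eq_one_or b with rfl | rfl <;>
    rcases Int.units_eq_one_or c with rfl | rfl <;>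
    rcases Int.units_eq_one_or d with rfl | rfl <;>
    rcases Int.units_eq_one_or s with rfl | rfl <;> revert h <;> decide

/-- Let `A` and `B` be graphs with the same column map whose labels between neighbouring columns
agree up to sign, and number the columns consecutively from `0` to `M`. After switching, the
labels agree between columns `i` and `i + 1`; if columns `M` and `0` are neighbours too, the
labels between these agree up to a common sign. The quotients of the labels of `A` by those of `B`
form a signing of the edges for which all quadrilaterals through two vertices of a column are
positive, so only the sign of a cycle around all columns remains free. -/
theorem exists_switch (hω : ω ≠ 0) (hA : A.IsHermitian) (hB : B.IsHermitian)
    (cA : ColStr ω A Finset.univ col) (cB : ColStr ω B Finset.univ col)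
    (hAB : ∀ x y, Nb (col x) (col y) → A x y = B x y ∨ A x y = -B x y)
    {M : ℕ} (hM : 1 ≤ M) (a : C) (n : V → ℕ) (hcol : ∀ x, col x = a + n x)
    (hn : ∀ x, n x ≤ M) (r : ℕ → V) (hr : ∀ i ≤ M, n (r i) = i) :
    ∃ (σ : V → ℤˣ) (η : ℤˣ),
      (∀ x y, n y = n x + 1 → A x y = ((σ x : ℤ) : ℂ) * B x y * ((σ y : ℤ) : ℂ)) ∧
      ∀ x y, n x = M → n y = 0 → Nb (col x) (col y) →
        A x y = ((η : ℤ) : ℂ) * (((σ x : ℤ) : ℂ) * B x y * ((σ y : ℤ) : ℂ)) := by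
  classical
  have mem : ∀ x : V, x ∈ Finset.univ := Finset.mem_univ
  set t : V → V → ℤˣ := fun x y => if A x y = B x y then 1 else -1 with ht
  have tA : ∀ x y, Nb (col x) (col y) → A x y = ((t x y : ℤ) : ℂ) * B x y := by
    intro x y hxy
    by_cases h : A x y = B x y
    · simp [ht, h]
    · simp only [ht, h, if_false]
      rw [(hAB x y hxy).resolve_left h]
      simp
  have tsymm : ∀ x y, t x y = t y x := by
    intro x y
    have : A x y = B x y ↔ A y x = B y x := by
      rw [← hA.apply x y, ← hB.apply x y, star_inj]
    simp [ht, this]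
  have tsq : ∀ x y, t x y * t x y = 1 := fun x y => Int.units_mul_self _
  have flat : ∀ x y p q, col x = col y → Nb (col x) (col p) → Nb (col x) (col q) →
      t x p * t p y * (t y q * t q x) = 1 := by
    intro x y p q hxy hxp hxq
    by_cases hne : x = y
    · subst hne
      rw [tsymm p x, tsymm q x, tsq, tsq, one_mul]
    have eA : ∀ {z}, Nb (col x) (col z) → A x z * A z x = B x z * B z x := by
      intro z hz
      rw [tA x z hz, tA z x hz.symm, tsymm z x]
      linear_combination B x z * B z x * unit_sq (t x z)
    have prod : A x p * A p y * (A y q * A q x) = B x p * B p y * (B y q * B q x) := by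
      by_cases hpq : col p = col q
      · rw [cA.same x (mem x) y (mem y) p (mem p) q (mem q) hxy hpq hxp,
          cB.same x (mem x) y (mem y) p (mem p) q (mem q) hxy hpq hxp, eA hxp, eA hxq]
      · rw [cA.opp x (mem x) y (mem y) p (mem p) q (mem q) hne hxy hpq hxp hxq,
          cB.opp x (mem x) y (mem y) p (mem p) q (mem q) hne hxy hpq hxp hxq, eA hxp, eA hxq]
    have hyp := hxy ▸ hxp
    have hyq := hxy ▸ hxq
    have hB0 : B x p * B p y * (B y q * B q x) ≠ 0 :=
      mul_ne_zero (mul_ne_zero (cB.ne_zero hω (mem x) (mem p) hxp)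
        (cB.ne_zero hω (mem p) (mem y) hyp.symm))
        (mul_ne_zero (cB.ne_zero hω (mem y) (mem q) hyq) (cB.ne_zero hω (mem q) (mem x) hxq.symm))
    rw [tA x p hxp, tA p y hyp.symm, tA y q hyq, tA q x hxq.symm] at prod
    have h1 : ((((t x p * t p y * (t y q * t q x) : ℤˣ) : ℤ)) : ℂ) = 1 := by
      apply mul_right_cancel₀ hB0
      push_cast
      linear_combination prod
    exact Units.ext (Int.cast_injective (α := ℂ) (h1.trans (by simp)))
  -- The switching is defined on one vertex `r i` of each column first, and then on the others by
  -- means of the chosen vertex of a neighbouring column.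
  let s : ℕ → ℤˣ := fun i => Nat.rec 1 (fun i si => si * t (r i) (r (i + 1))) i
  have s0 : s 0 = 1 := rfl
  have s_succ : ∀ i, s (i + 1) = s i * t (r i) (r (i + 1)) := fun i => rfl
  set b : ℕ → ℕ := fun i => if i = 0 then 1 else i - 1 with hb
  set σ : V → ℤˣ := fun x => s (b (n x)) * t (r (b (n x))) x with hσ
  have nb_of : ∀ x y, n y = n x + 1 → Nb (col x) (col y) := fun x y h => by
    rw [hcol, hcol, h]
    exact Or.inl (by push_cast; ring)
  have nb_b : ∀ x, Nb (col x) (col (r (b (n x)))) := by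
    intro x
    have hx := hn x
    by_cases h : n x = 0
    · have h1 : b (n x) = 1 := by simp [hb, h]
      exact nb_of _ _ (by rw [h1, hr 1 hM, h])
    · have h1 : b (n x) = n x - 1 := by simp [hb, h]
      exact (nb_of _ _ (by rw [h1, hr _ (by omega)]; omega)).symm
  have σr : ∀ i ≤ M, σ (r i) = s i := by
    intro i hi
    simp only [hσ, hr i hi]
    rcases i with - | i
    · simp only [hb, if_true]
      rw [show s 1 = s 0 * t (r 0) (r 1) from rfl, s0, tsymm (r 1) (r 0), one_mul, tsq]
    · simp only [hb, Nat.succ_ne_zero, if_false, Nat.add_sub_cancel]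
      exact (s_succ i).symm
  have key : ∀ x y q, n x = n y → Nb (col x) (col q) → t x q = σ x * σ y * t y q := by
    intro x y q hxy hxq
    have hc : col x = col y := by rw [hcol, hcol, hxy]
    have h1 := flat x y (r (b (n x))) q hc (nb_b x) hxq
    rw [tsymm x q, unit_eq_of_mul (s := s (b (n x))) h1]
    simp only [hσ, ← hxy]
    rw [tsymm x]
  have main : ∀ x y, n y = n x + 1 → t x y = σ x * σ y := by
    intro x y hxy
    have hx := hn y
    have hrx : n (r (n x)) = n x := hr _ (by omega)
    rw [key x (r (n x)) y hrx.symm (nb_of x y hxy), σr _ (by omega)]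
    have : σ y = s (n x) * t (r (n x)) y := by simp [hσ, hb, hxy]
    rw [this]
    have h2 := Int.units_mul_self (s (n x))
    rw [mul_assoc]
  refine ⟨σ, σ (r M) * σ (r 0) * t (r M) (r 0), fun x y hxy => ?_, fun x y hx hy hxy => ?_⟩
  · rw [tA x y (nb_of x y hxy), main x y hxy]
    push_cast
    ring
  · have h1 : t x y = σ x * σ y * (σ (r M) * σ (r 0) * t (r M) (r 0)) := by
      have hrM := hr M le_rfl
      have hr0 := hr 0 (by omega)
      have hxy' : Nb (col y) (col (r M)) := by
        rw [hcol (r M), hrM, ← hx, ← hcol]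
        exact hxy.symm
      rw [key x (r M) y (hx.trans hrM.symm) hxy, tsymm (r M) y,
        key y (r 0) (r M) (hy.trans hr0.symm) hxy', tsymm (r 0)]
      ac_rfl
    rw [tA x y hxy, h1]
    push_cast
    ring

/-- Graphs that agree on the diagonal and between neighbouring columns agree. -/
theorem eq_of_switch (hω : ω ≠ 0) (hA : A.IsHermitian) (hB : B.IsHermitian)
    (cA : ColStr ω A Finset.univ col) (cB : ColStr ω B Finset.univ col) (σ : V → ℤˣ)
    (hdiag : ∀ x, A x x = B x x)
    (hnb : ∀ x y, col y = col x + 1 → A x y = ((σ x : ℤ) : ℂ) * B x y * ((σ y : ℤ) : ℂ))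
    (hex : ∀ x, ∃ p, Nb (col x) (col p)) (x y : V) :
    A x y = ((σ x : ℤ) : ℂ) * B x y * ((σ y : ℤ) : ℂ) := by
  have mem : ∀ x : V, x ∈ Finset.univ := Finset.mem_univ
  have both : ∀ x y, Nb (col x) (col y) →
      A x y = ((σ x : ℤ) : ℂ) * B x y * ((σ y : ℤ) : ℂ) := by
    rintro x y (h | h)
    · exact hnb x y h
    · rw [← hA.apply x y, ← hB.apply x y, hnb y x h]
      simp only [star_mul', star_intCast]
      ring
  by_cases h1 : Nb (col x) (col y)
  · exact both x y h1
  by_cases hxy : x = y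
  · subst hxy
    rw [hdiag x]
    linear_combination -B x x * unit_sq (σ x)
  by_cases h2 : col x = col y
  · obtain ⟨p, hp⟩ := hex x
    have e1 := cA.twin x (mem x) y (mem y) p (mem p) hxy h2 hp
    have e2 := cB.twin x (mem x) y (mem y) p (mem p) hxy h2 hp
    have n1 := cB.ne_zero hω (mem y) (mem p) (h2 ▸ hp)
    have n2 := cB.ne_zero hω (mem p) (mem x) hp.symm
    rw [both y p (h2 ▸ hp), both p x hp.symm, both x p hp, hdiag x] at e1
    have hx := unit_sq (σ x)
    have hy := unit_sq (σ y)
    have hp' := unit_sq (σ p)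
    apply mul_right_cancel₀ n1
    apply mul_right_cancel₀ n2
    have e3 : A x y * (((σ y : ℤ) : ℂ) * B y p * ((σ p : ℤ) : ℂ)) *
        (((σ p : ℤ) : ℂ) * B p x * ((σ x : ℤ) : ℂ)) = B x y * B y p * B p x := by
      rw [e1, e2]
      linear_combination -(B x x * B x p * B p x) * (((σ x : ℤ) : ℂ) * ((σ x : ℤ) : ℂ) * hp' + hx)
    linear_combination (((σ x : ℤ) : ℂ) * ((σ y : ℤ) : ℂ)) * e3 -
      A x y * B y p * B p x * (((σ x : ℤ) : ℂ) * (σ x : ℤ) * ((σ y : ℤ) : ℂ) * (σ y : ℤ) * hp' +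
        ((σ x : ℤ) : ℂ) * (σ x : ℤ) * hy + hx)
  · have e1 : A x y = 0 := by
      by_contra h0
      exact (cA.near x (mem x) y (mem y) h0).elim h2 h1
    have e2 : B x y = 0 := by
      by_contra h0
      exact (cB.near x (mem x) y (mem y) h0).elim h2 h1
    rw [e1, e2]
    ring

variable {W : Type*} {B' : Matrix W W ℂ} {g h o : C → ℂ} {ψ : W → C × Fin 2} {row : V → Fin 2}

theorem ladderModel_colStr [FarCols C] (H : LadderLabels ω g h o (Set.range ψ))
    (hrow : ∀ x y, x ≠ y → col x = col y → row x ≠ row y)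
    (hmem : ∀ x, (col x, row x) ∈ Set.range ψ) :
    ColStr ω (Matrix.of fun x y => ladderModel g h o (col x, row x) (col y, row y))
      Finset.univ col := by
  refine colStr_of_ladderModel (g := g) (h := h) (o := o) (Φ := fun x => (col x, row x))
    (fun x _ y _ hxy => ?_) (fun _ => 1) (fun x _ y _ => by simp) (H.mono ?_)
  · by_contra hne
    simp only [Prod.mk.injEq] at hxy
    exact hrow x y hne hxy.1 hxy.2
  · rintro _ ⟨x, -, rfl⟩
    exact hmem x

omit [Fintype V] [CommRing C] in
theorem row_injective (hrow : ∀ x y, x ≠ y → col x = col y → row x ≠ row y) :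
    Function.Injective fun x => (col x, row x) := by
  intro x y hxy
  by_contra hne
  simp only [Prod.mk.injEq] at hxy
  exact hrow x y hne hxy.1 hxy.2

theorem exists_row (cA : ColStr ω A Finset.univ col) :
    ∃ row : V → Fin 2, (∀ x y, x ≠ y → col x = col y → row x ≠ row y) ∧
      ∀ x, (∀ z, col z = col x → z = x) → row x = 0 := by
  classical
  rcases isEmpty_or_nonempty V with hV | hV
  · exact ⟨fun _ => 0, fun x => hV.elim x, fun x => hV.elim x⟩
  have rep : ∀ x, col (Function.invFun col (col x)) = col x := fun x =>
    Function.invFun_eq ⟨x, rfl⟩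
  refine ⟨fun x => if x = Function.invFun col (col x) then 0 else 1, fun x y hxy hc => ?_,
    fun x hx => if_pos (hx _ (rep x)).symm⟩
  have hf := cA.fiber x (Finset.mem_univ x) y (Finset.mem_univ y)
    (Function.invFun col (col x)) (Finset.mem_univ _) hc (rep x).symm
  beta_reduce
  rw [← hc]
  rcases hf with h | h | h
  · exact absurd h hxy
  · rw [if_pos h, if_neg fun h1 => hxy (h.trans h1.symm)]
    decide
  · rw [if_pos h, if_neg fun h1 => hxy (h1.trans h.symm)]
    decide

end Switch

section Embed

variable {V W : Type*} [Fintype V] {ω : ℂ} {A : Matrix V V ℂ}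

/-- A graph with columns `a, …, b` on a line is a subgraph of a family member `B`, given as part
of the universal ladder, as soon as the charges, the labels up to sign, and the columns fit. -/
theorem equivToSubgraph_of_line {B : Matrix W W ℂ} {g h o : ℤ → ℂ} {ψ : W → ℤ × Fin 2}
    {col : V → ℤ} {row : V → Fin 2} (hω : ω ≠ 0) (hA : A.IsHermitian)
    (cA : ColStr ω A Finset.univ col)
    {a b : ℤ} (hab : a < b) (hcol : ∀ x, a ≤ col x ∧ col x ≤ b)
    (hsurj : ∀ c, a ≤ c → c ≤ b → ∃ x, col x = c)
    (hB : ∀ p q, B p q = ladderModel g h o (ψ p) (ψ q))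
    (H : LadderLabels ω g h o (Set.range ψ)) (hh : ∀ c, (starRingEnd ℂ) (h c) = h c)
    (ho : ∀ c, (starRingEnd ℂ) (o c) = o c)
    (hrow : ∀ x y, x ≠ y → col x = col y → row x ≠ row y)
    (hmem : ∀ x, (col x, row x) ∈ Set.range ψ)
    (hg : ∀ x y, col y = col x + 1 → A x y = g (col x) ∨ A x y = -g (col x))
    (hdiag : ∀ x, A x x = h (col x)) : EquivToSubgraph A B := by
  set D : Matrix V V ℂ :=
    Matrix.of fun x y => ladderModel g h o (col x, row x) (col y, row y) with hD
  have cD : ColStr ω D Finset.univ col := ladderModel_colStr H hrow hmem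
  have hDh : D.IsHermitian := by
    ext x y
    exact ladderModel_isHermitian_apply hh ho _ _
  have fwd : ∀ x y, col y = col x + 1 → A x y = D x y ∨ A x y = -D x y := by
    intro x y hxy
    rw [hD, Matrix.of_apply, ladderModel_right (p := (col x, row x)) (q := (col y, row y)) hxy]
    have h1 := hg x y hxy
    rcases rowSign_eq (row x) with h2 | h2 <;> rw [h2]
    · simpa using h1
    · simpa using h1.symm
  have hAD : ∀ x y, Nb (col x) (col y) → A x y = D x y ∨ A x y = -D x y := by
    rintro x y (hxy | hxy)
    · exact fwd x y hxy
    · rw [← hA.apply x y, ← hDh.apply x y]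
      rcases fwd y x hxy with h1 | h1
      · exact Or.inl (by rw [h1])
      · exact Or.inr (by rw [h1, star_neg])
  have : ∀ i : ℕ, ∃ x, a + i ≤ b → col x = a + i := by
    intro i
    by_cases hi : a + i ≤ b
    · obtain ⟨x, hx⟩ := hsurj (a + i) (by omega) hi
      exact ⟨x, fun _ => hx⟩
    · obtain ⟨x, -⟩ := hsurj a le_rfl hab.le
      exact ⟨x, fun h => absurd h hi⟩
  choose r hr using this
  obtain ⟨σ, -, hσ, -⟩ := exists_switch hω hA hDh cA cD hAD (M := (b - a).toNat) (by omega) a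
    (fun x => (col x - a).toNat) (fun x => by have := hcol x; simp; omega)
    (fun x => by have := hcol x; omega) r (fun i hi => by
      have := hr i (by omega)
      omega)
  refine equivToSubgraph_of_model hB (row_injective hrow) hmem σ
    (eq_of_switch hω hA hDh cA cD σ (fun x => ?_) (fun x y hxy => hσ x y ?_) fun x => ?_)
  · rw [hdiag x, hD, Matrix.of_apply, ladderModel_same rfl, if_pos rfl]
  · have := hcol x
    omega
  · have := hcol x
    by_cases hx : col x = b
    · obtain ⟨p, hp⟩ := hsurj (col x - 1) (by omega) (by omega)
      exact ⟨p, Or.inr (by omega)⟩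
    · obtain ⟨p, hp⟩ := hsurj (col x + 1) (by omega) (by omega)
      exact ⟨p, Or.inl hp⟩

theorem norm_edgeLabels (hω : ω * (starRingEnd ℂ) ω = 2) {z : ℂ} (hz : z ∈ edgeLabels ω)
    (h1 : z * (starRingEnd ℂ) z = 1) : z = 1 ∨ z = -1 := by
  have h2 : (starRingEnd ℂ) ω * ω = 2 := by rw [mul_comm, hω]
  simp only [edgeLabels, Set.mem_insert_iff, Set.mem_singleton_iff] at hz
  rcases hz with rfl | rfl | rfl | rfl | rfl | rfl
  · exact Or.inl rfl
  · exact Or.inr rfl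
  all_goals
    simp only [map_neg, Complex.conj_conj, neg_mul_neg, hω, h2] at h1
    norm_num at h1

theorem rowSign_add_one (r : Fin 2) : rowSign (r + 1) = -rowSign r := by
  fin_cases r <;> simp [rowSign]

/-- A graph whose columns form a full cycle is a subgraph of a toroidal graph. If the cycle has
the wrong sign, this is repaired by exchanging the two rows of the toroidal graph in column `0`. -/
theorem equivToSubgraph_graphT {m : ℕ} (hm : 5 ≤ m) (hω : ω * (starRingEnd ℂ) ω = 2)
    (hA : A.IsHermitian) {col : V → ZMod m} (hsurj : Function.Surjective col)
    (cA : ColStr ω A Finset.univ col) : EquivToSubgraph A (graphT m) := by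
  have := farCols_zmod (m := m) (by omega)
  have : NeZero m := ⟨by omega⟩
  have mem : ∀ x : V, x ∈ Finset.univ := Finset.mem_univ
  have hω0 : ω ≠ 0 := by rintro rfl; simp at hω
  obtain ⟨row, hrow, -⟩ := exists_row cA
  have two : ∀ x p q, col p = col x + 1 → col x = col q + 1 → col p ≠ col q := by
    intro x p q h1 h2 h3
    exact FarCols.two (C := ZMod m) (by linear_combination h3 - h1 - h2)
  have other : ∀ x y, Nb (col x) (col y) → ∃ z, Nb (col x) (col z) ∧ col z ≠ col y := by
    rintro x y (h1 | h1)
    · obtain ⟨z, hz⟩ := hsurj (col x - 1)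
      have hz' : col x = col z + 1 := by rw [hz]; ring
      exact ⟨z, Or.inr hz', (two x y z h1 hz').symm⟩
    · obtain ⟨z, hz⟩ := hsurj (col x + 1)
      exact ⟨z, Or.inl hz, two x z y hz h1⟩
  have diag : ∀ x, A x x = 0 := by
    intro x
    by_contra h0
    obtain ⟨p, hp⟩ := hsurj (col x + 1)
    obtain ⟨q, hq, hqp⟩ := other x p (Or.inl hp)
    exact hqp (cA.charge_end x (mem x) q (mem q) p (mem p) h0 hq (Or.inl hp))
  have unit : ∀ x y, Nb (col x) (col y) → A x y = 1 ∨ A x y = -1 := by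
    intro x y hxy
    refine norm_edgeLabels hω (cA.label x (mem x) y (mem y) hxy) ?_
    rw [show (starRingEnd ℂ) (A x y) = A y x from hA.apply y x]
    by_contra hne
    rcases cA.heavy x (mem x) y (mem y) hxy hne with h | h
    · obtain ⟨z, hz, hzy⟩ := other x y hxy
      exact hzy ((h.2 z (mem z)).2 hz)
    · obtain ⟨z, hz, hzx⟩ := other y x hxy.symm
      exact hzx ((h.2 z (mem z)).2 hz)
  have range : ∀ p : ZMod m × Fin 2,
      p ∈ Set.range fun p : LadderVertex m => (((p.1 : ℕ) : ZMod m), p.2) := fun p =>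
    ⟨(⟨p.1.val, ZMod.val_lt _⟩, p.2), Prod.ext (by simp) rfl⟩
  set D : Matrix V V ℂ := Matrix.of fun x y => ladderModel (fun _ => 1) (fun _ => 0) (fun _ => 0)
    (col x, row x) (col y, row y) with hD
  have cD : ColStr ω D Finset.univ col := ladderModel_colStr
    (ψ := fun p : LadderVertex m => (((p.1 : ℕ) : ZMod m), p.2))
    ⟨fun _ => by simp [edgeLabels], fun _ => Or.inl rfl, fun _ _ => Or.inl ⟨rfl, rfl⟩,
      fun _ _ _ _ _ h1 => by simp at h1⟩ hrow (fun x => range _)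
  have hDh : D.IsHermitian := by
    ext x y
    exact ladderModel_isHermitian_apply (C := ZMod m) (g := fun _ => 1) (h := fun _ => 0)
      (o := fun _ => 0) (fun _ => map_zero _) (fun _ => map_zero _) _ _
  have right : ∀ x y, col y = col x + 1 → D x y = rowSign (row x) := fun x y hxy => by
    rw [hD, Matrix.of_apply, ladderModel_right (p := (col x, row x)) (q := (col y, row y)) hxy,
      mul_one]
  have hAD : ∀ x y, Nb (col x) (col y) → A x y = D x y ∨ A x y = -D x y := by
    have h1 : ∀ x y, Nb (col x) (col y) → D x y = 1 ∨ D x y = -1 := by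
      rintro x y (hxy | hxy)
      · rw [right x y hxy]
        exact rowSign_eq _
      · rw [← hDh.apply x y, right y x hxy]
        rcases rowSign_eq (row y) with h2 | h2 <;> simp [h2]
    intro x y hxy
    rcases unit x y hxy with h2 | h2 <;> rcases h1 x y hxy with h3 | h3 <;> simp [h2, h3]
  choose r hr using fun i : ℕ => hsurj (i : ZMod m)
  obtain ⟨σ, η, hσ, hη⟩ := exists_switch hω0 hA hDh cA cD hAD (M := m - 1) (by omega) 0
    (fun x => (col x).val) (fun x => by simp) (fun x => by have := ZMod.val_lt (col x); omega) r
    (fun i hi => by rw [hr, ZMod.val_natCast, Nat.mod_eq_of_lt (by omega)])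
  -- The rows and the switching, changed in column `0` if the sign `η` is negative.
  set row' : V → Fin 2 := fun x => if η = -1 ∧ col x = 0 then row x + 1 else row x with hrow'
  set τ : V → ℤˣ := fun x => if η = -1 ∧ col x = 0 then -σ x else σ x with hτ
  have hrow'' : ∀ x y, x ≠ y → col x = col y → row' x ≠ row' y := by
    intro x y hne hxy
    have := hrow x y hne hxy
    simp only [hrow', ← hxy]
    split_ifs
    · exact fun h => this (add_right_cancel h)
    · exact this
  set E : Matrix V V ℂ := Matrix.of fun x y => ladderModel (fun _ => 1) (fun _ => 0) (fun _ => 0)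
    (col x, row' x) (col y, row' y) with hE
  have cE : ColStr ω E Finset.univ col := ladderModel_colStr
    (ψ := fun p : LadderVertex m => (((p.1 : ℕ) : ZMod m), p.2))
    ⟨fun _ => by simp [edgeLabels], fun _ => Or.inl rfl, fun _ _ => Or.inl ⟨rfl, rfl⟩,
      fun _ _ _ _ _ h1 => by simp at h1⟩ hrow'' (fun x => range _)
  have hEh : E.IsHermitian := by
    ext x y
    exact ladderModel_isHermitian_apply (C := ZMod m) (g := fun _ => 1) (h := fun _ => 0)
      (o := fun _ => 0) (fun _ => map_zero _) (fun _ => map_zero _) _ _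
  have rightE : ∀ x y, col y = col x + 1 → E x y = rowSign (row' x) := fun x y hxy => by
    rw [hE, Matrix.of_apply, ladderModel_right (p := (col x, row' x)) (q := (col y, row' y)) hxy,
      mul_one]
  refine equivToSubgraph_of_model (ψ := fun p : LadderVertex m => (((p.1 : ℕ) : ZMod m), p.2))
    graphT_eq_model (row_injective hrow'') (fun x => range _) τ
    (eq_of_switch hω0 hA hEh cA cE τ (fun x => ?_) (fun x y hxy => ?_) fun x => ?_)
  · rw [diag x, hE, Matrix.of_apply, ladderModel_same rfl, if_pos rfl]
  · rw [rightE x y hxy]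
    have hval := int_nb_zmod_val (m := m) (by omega) (a := col x) (b := col y)
    have h10 : (1 : ZMod m) ≠ 0 := FarCols.one
    by_cases hy : col y = 0
    · -- The edges from the last column to column `0`.
      have hx : col x = -1 := by linear_combination hy - hxy
      have hx0 : col x ≠ 0 := by rw [hx]; exact neg_ne_zero.2 h10
      have hxv : (col x).val = m - 1 := by
        obtain ⟨m, rfl⟩ : ∃ k, m = k + 1 := ⟨m - 1, by omega⟩
        rw [hx, ZMod.val_neg_one]; rfl
      have h1 := hη x y hxv (by rw [hy, ZMod.val_zero]) (Or.inl hxy)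
      rw [right x y hxy] at h1
      rw [h1]
      rcases Int.units_eq_one_or η with h2 | h2
      · simp [hτ, hrow', h2]
      · simp [hτ, hrow', h2, hx0, hy]
    · have h1 := hσ x y (by have := (hval hy).2 hxy; exact_mod_cast this)
      rw [right x y hxy] at h1
      rw [h1]
      by_cases h2 : η = -1 ∧ col x = 0
      · simp [hτ, hrow', h2, hy, rowSign_add_one]
      · simp [hτ, hrow', h2, hy]
  · obtain ⟨p, hp⟩ := hsurj (col x + 1)
    exact ⟨p, Or.inl hp⟩

end Embed

/-! ### Negation and complex conjugation -/

section Symmetry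

variable {V W : Type*} {C : Type*} [CommRing C] {ω : ℂ} {A : Matrix V V ℂ} {S : Finset V}
  {col : V → C} {d : ℤ}

theorem ColStr.neg (h : ColStr ω A S col) : ColStr ω (-A) S col where
  near x hx y hy h0 := h.near x hx y hy (neg_ne_zero.1 h0)
  label x hx y hy hxy := edgeLabels_neg (h.label x hx y hy hxy)
  fiber := h.fiber
  charge x hx := by
    rcases h.charge x hx with h1 | h1 | h1 <;> simp [h1]
  same x hx y hy p hp q hq hxy hpq hxp := by
    simpa only [Matrix.neg_apply, neg_mul_neg] using h.same x hx y hy p hp q hq hxy hpq hxp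
  opp x hx y hy p hp q hq hne hxy hpq hxp hxq := by
    simpa only [Matrix.neg_apply, neg_mul_neg] using
      h.opp x hx y hy p hp q hq hne hxy hpq hxp hxq
  ratio x hx y hy p hp hxy hxp := by
    rcases h.ratio x hx y hy p hp hxy hxp with h1 | h1 <;> simp [h1]
  twin x hx y hy p hp hne hxy hxp := by
    simp only [Matrix.neg_apply]
    linear_combination -h.twin x hx y hy p hp hne hxy hxp
  charge_end x hx p hp q hq h0 := h.charge_end x hx p hp q hq (neg_ne_zero.1 h0)
  heavy x hx y hy hxy hne := by
    simp only [Matrix.neg_apply, neg_mul_neg, neg_eq_zero] at hne ⊢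
    exact h.heavy x hx y hy hxy hne

theorem ColStr.conj (h : ColStr ω A S col) : ColStr ω (A.map (starRingEnd ℂ)) S col where
  near x hx y hy h0 := h.near x hx y hy (by simpa using h0)
  label x hx y hy hxy := edgeLabels_conj (h.label x hx y hy hxy)
  fiber := h.fiber
  charge x hx := by
    rcases h.charge x hx with h1 | h1 | h1 <;> simp [h1]
  same x hx y hy p hp q hq hxy hpq hxp := by
    simpa only [Matrix.map_apply, map_mul] using
      congrArg (starRingEnd ℂ) (h.same x hx y hy p hp q hq hxy hpq hxp)
  opp x hx y hy p hp q hq hne hxy hpq hxp hxq := by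
    simpa only [Matrix.map_apply, map_mul, map_neg] using
      congrArg (starRingEnd ℂ) (h.opp x hx y hy p hp q hq hne hxy hpq hxp hxq)
  ratio x hx y hy p hp hxy hxp := by
    rcases h.ratio x hx y hy p hp hxy hxp with h1 | h1 <;> simp [h1]
  twin x hx y hy p hp hne hxy hxp := by
    simpa only [Matrix.map_apply, map_mul, map_neg] using
      congrArg (starRingEnd ℂ) (h.twin x hx y hy p hp hne hxy hxp)
  charge_end x hx p hp q hq h0 := h.charge_end x hx p hp q hq (by simpa using h0)
  heavy x hx y hy hxy hne := by
    simp only [Matrix.map_apply, ← map_mul, map_eq_zero] at hne ⊢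
    exact h.heavy x hx y hy hxy fun h1 => hne (by rw [h1, map_one])

theorem EquivToSubgraph.of_neg {B : Matrix W W ℂ} (h : EquivToSubgraph (-A) B) :
    EquivToSubgraph A B := by
  obtain ⟨f, σ, ε, θ, hθ, hf, hA⟩ := equivToSubgraph_iff.1 h
  refine equivToSubgraph_iff.2 ⟨f, σ, -ε, θ, hθ, hf, fun i j => ?_⟩
  have := hA i j
  rw [Matrix.neg_apply] at this
  push_cast
  linear_combination -this

theorem EquivToSubgraph.of_conj {B : Matrix W W ℂ}
    (h : EquivToSubgraph (A.map (starRingEnd ℂ)) B) : EquivToSubgraph A B := by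
  obtain ⟨f, σ, ε, θ, hθ, hf, hA⟩ := equivToSubgraph_iff.1 h
  refine equivToSubgraph_iff.2 ⟨f, σ, ε, (starRingEnd ℂ).comp θ, ?_, hf, fun i j => ?_⟩
  · rcases hθ with rfl | rfl
    · exact Or.inr (RingHom.comp_id _)
    · exact Or.inl (RingHom.ext fun z => Complex.conj_conj z)
  · have := congrArg (starRingEnd ℂ) (hA i j)
    simpa using this

theorem InFamilies.of_imp {A' : Matrix V V ℂ} (H : ∀ {W : Type} {B : Matrix W W ℂ},
    EquivToSubgraph A' B → EquivToSubgraph A B) (h : InFamilies d A') : InFamilies d A := by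
  rcases h with ⟨k, hk, h⟩ | ⟨k, hk, ε, h⟩ | ⟨k, hk, h⟩ | ⟨hd, k, hk, h⟩ | ⟨k, hk, h⟩
  · exact Or.inl ⟨k, hk, H h⟩
  · exact Or.inr (Or.inl ⟨k, hk, ε, H h⟩)
  · exact Or.inr (Or.inr (Or.inl ⟨k, hk, H h⟩))
  · exact Or.inr (Or.inr (Or.inr (Or.inl ⟨hd, k, hk, H h⟩)))
  · exact Or.inr (Or.inr (Or.inr (Or.inr ⟨k, hk, H h⟩)))

end Symmetry

/-! ### Lines of columns -/

/-- The labels `z` between the first two columns, and the charge `α` of the first column, of a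
graph whose columns form a line starting at column `0`. If `z` is not `1`, the first column is a
single uncharged vertex. -/
structure LeftEnd {V : Type*} (ω : ℂ) (A : Matrix V V ℂ) (col : V → ℤ) (z α : ℂ) : Prop where
  label : z = 1 ∨ z = ω ∨ z = (starRingEnd ℂ) ω
  charge : α = 0 ∨ α = 1 ∨ α = -1
  edge : ∀ x y, col x = 0 → col y = 1 → A x y = z ∨ A x y = -z
  diag : ∀ x, col x = 0 → A x x = α
  single : z ≠ 1 → α = 0 ∧ ∀ x y, col x = 0 → col y = 0 → x = y

/-- A column structure with columns `0, …, M`. -/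
structure LineStr {V : Type*} [Fintype V] (ω : ℂ) (A : Matrix V V ℂ) (col : V → ℤ) (M : ℤ) :
    Prop where
  norm : ω * (starRingEnd ℂ) ω = 2
  herm : A.IsHermitian
  colStr : ColStr ω A Finset.univ col
  three_le : 3 ≤ M
  range : ∀ x, 0 ≤ col x ∧ col x ≤ M
  surj : ∀ c, 0 ≤ c → c ≤ M → ∃ x, col x = c

section Line

variable {V : Type*} [Fintype V] {ω : ℂ} {A : Matrix V V ℂ} {col : V → ℤ} {M : ℤ} {z w α β : ℂ}

theorem LineStr.neg (L : LineStr ω A col M) : LineStr ω (-A) col M :=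
  ⟨L.norm, L.herm.neg, L.colStr.neg, L.three_le, L.range, L.surj⟩

theorem LineStr.conj (L : LineStr ω A col M) : LineStr ω (A.map (starRingEnd ℂ)) col M :=
  ⟨L.norm, by
    ext x y
    exact congrArg (starRingEnd ℂ) (L.herm.apply x y), L.colStr.conj, L.three_le, L.range, L.surj⟩

theorem LineStr.reflect (L : LineStr ω A col M) : LineStr ω A (fun x => M - col x) M :=
  ⟨L.norm, L.herm, L.colStr.of_iff subset_rfl (fun x _ y _ => by omega)
    (fun x _ y _ => by unfold Nb; omega), L.three_le, fun x => by have := L.range x; omega,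
    fun c h0 h1 => by
      obtain ⟨x, hx⟩ := L.surj (M - c) (by omega) (by omega)
      exact ⟨x, by omega⟩⟩

omit [Fintype V] in
theorem LeftEnd.neg (h : LeftEnd ω A col z α) : LeftEnd ω (-A) col z (-α) where
  label := h.label
  charge := by rcases h.charge with h1 | h1 | h1 <;> simp [h1]
  edge x y hx hy := by rcases h.edge x y hx hy with h1 | h1 <;> simp [h1]
  diag x hx := by simp [h.diag x hx]
  single hz := by simpa using h.single hz

omit [Fintype V] in
theorem LeftEnd.conj (h : LeftEnd ω A col z α) :
    LeftEnd ω (A.map (starRingEnd ℂ)) col ((starRingEnd ℂ) z) α where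
  label := by rcases h.label with h1 | h1 | h1 <;> simp [h1]
  charge := h.charge
  edge x y hx hy := by rcases h.edge x y hx hy with h1 | h1 <;> simp [h1]
  diag x hx := by
    rw [Matrix.map_apply, h.diag x hx]
    rcases h.charge with h1 | h1 | h1 <;> simp [h1]
  single hz := h.single fun h1 => hz (by rw [h1, map_one])

theorem LineStr.ne_zero (L : LineStr ω A col M) : ω ≠ 0 := by
  rintro rfl
  simpa using L.norm

theorem LineStr.norm_eq (L : LineStr ω A col M) (x y : V) :
    A x y * A y x = A x y * (starRingEnd ℂ) (A x y) := by
  rw [show (starRingEnd ℂ) (A x y) = A y x from L.herm.apply y x]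

/-- Labels between two neighbouring columns agree up to sign. -/
theorem LineStr.edge_eq (L : LineStr ω A col M) {x y x' y' : V} (hx : col x = col x')
    (hy : col y = col y') (hxy : Nb (col x) (col y)) : A x y = A x' y' ∨ A x y = -A x' y' := by
  have h1 := L.colStr.ratio x (Finset.mem_univ x) x' (Finset.mem_univ x') y (Finset.mem_univ y)
    hx hxy
  have h2 := L.colStr.ratio y (Finset.mem_univ y) y' (Finset.mem_univ y') x' (Finset.mem_univ x')
    hy (hx ▸ hxy.symm)
  have h3 : A x' y = A x' y' ∨ A x' y = -A x' y' := by
    rw [← L.herm.apply x' y, ← L.herm.apply x' y']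
    rcases h2 with h2 | h2 <;> simp [h2]
  rcases h1 with h1 | h1 <;> rcases h3 with h3 | h3 <;> simp [h1, h3]

theorem LineStr.diag_eq (L : LineStr ω A col M) {x y p : V} (hxy : col x = col y)
    (hp : Nb (col x) (col p)) : A x x = A y y := by
  by_cases hne : x = y
  · rw [hne]
  have mem : ∀ x : V, x ∈ Finset.univ := Finset.mem_univ
  have e1 := congrArg (starRingEnd ℂ)
    (L.colStr.twin x (mem x) y (mem y) p (mem p) hne hxy hp)
  have e2 := L.colStr.twin y (mem y) x (mem x) p (mem p) (Ne.symm hne) hxy.symm (hxy ▸ hp)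
  have hc : ∀ a b, (starRingEnd ℂ) (A a b) = A b a := fun a b => L.herm.apply b a
  simp only [map_mul, map_neg, hc] at e1
  have e3 : A x p * A p x = A y p * A p y := by
    rw [L.norm_eq, L.norm_eq]
    rcases L.edge_eq hxy rfl hp with h | h <;> simp [h]
  have h0 : A x p * A p x ≠ 0 := mul_ne_zero (L.colStr.ne_zero L.ne_zero (mem x) (mem p) hp)
    (L.colStr.ne_zero L.ne_zero (mem p) (mem x) hp.symm)
  apply mul_right_cancel₀ h0
  linear_combination e1 - e2 - A y y * e3

theorem LineStr.unit_of_norm (L : LineStr ω A col M) {x y : V} (hxy : Nb (col x) (col y))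
    (h : A x y * A y x = 1) : A x y = 1 ∨ A x y = -1 :=
  norm_edgeLabels L.norm (L.colStr.label x (Finset.mem_univ x) y (Finset.mem_univ y) hxy)
    (by rwa [← L.norm_eq])

theorem LineStr.exists_leftEnd (L : LineStr ω A col M) : ∃ z α, LeftEnd ω A col z α := by
  have mem : ∀ x : V, x ∈ Finset.univ := Finset.mem_univ
  have hM := L.three_le
  obtain ⟨a, ha⟩ := L.surj 0 le_rfl (by omega)
  obtain ⟨b, hb⟩ := L.surj 1 (by omega) (by omega)
  obtain ⟨c, hc⟩ := L.surj 2 (by omega) (by omega)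
  have hab : Nb (col a) (col b) := Or.inl (by omega)
  have edge : ∀ x y, col x = 0 → col y = 1 → A x y = A a b ∨ A x y = -A a b :=
    fun x y hx hy => L.edge_eq (hx.trans ha.symm) (hy.trans hb.symm) (Or.inl (by omega))
  have diag : ∀ x, col x = 0 → A x x = A a a := fun x hx =>
    L.diag_eq (p := b) (hx.trans ha.symm) (Or.inl (by omega))
  have of_label : ∀ z, (z = 1 ∨ z = ω ∨ z = (starRingEnd ℂ) ω) → (A a b = z ∨ A a b = -z) →
      (z ≠ 1 → A a a = 0 ∧ ∀ x y, col x = 0 → col y = 0 → x = y) →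
      ∃ z α, LeftEnd ω A col z α := by
    intro z hz hzab hs
    refine ⟨z, A a a, hz, L.colStr.charge a (mem a), fun x y hx hy => ?_, diag, hs⟩
    rcases edge x y hx hy with h1 | h1 <;> rcases hzab with h2 | h2 <;> simp [h1, h2]
  by_cases hn : A a b * A b a = 1
  · exact of_label 1 (Or.inl rfl) (L.unit_of_norm hab hn) fun h => absurd rfl h
  · have hs : A a a = 0 ∧ ∀ x y, col x = 0 → col y = 0 → x = y := by
      rcases L.colStr.heavy a (mem a) b (mem b) hab hn with h1 | h1
      · exact ⟨h1.1, fun x y hx hy => ((h1.2 x (mem x)).1 (hx.trans ha.symm)).trans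
          ((h1.2 y (mem y)).1 (hy.trans ha.symm)).symm⟩
      · have := (h1.2 c (mem c)).2 (Or.inl (by omega))
        omega
    have hl := L.colStr.label a (mem a) b (mem b) hab
    rw [L.norm_eq] at hn
    simp only [edgeLabels, Set.mem_insert_iff, Set.mem_singleton_iff] at hl
    rcases hl with h1 | h1 | h1 | h1 | h1 | h1
    · simp [h1] at hn
    · simp [h1] at hn
    · exact of_label ω (by simp) (Or.inl h1) fun _ => hs
    · exact of_label ω (by simp) (Or.inr h1) fun _ => hs
    · exact of_label _ (by simp) (Or.inl h1) fun _ => hs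
    · exact of_label _ (by simp) (Or.inr h1) fun _ => hs

theorem LineStr.inner_diag (L : LineStr ω A col M) {x : V} (h0 : 0 < col x) (hM : col x < M) :
    A x x = 0 := by
  by_contra hne
  obtain ⟨p, hp⟩ := L.surj (col x + 1) (by omega) (by omega)
  obtain ⟨q, hq⟩ := L.surj (col x - 1) (by omega) (by omega)
  have := L.colStr.charge_end x (Finset.mem_univ x) p (Finset.mem_univ p) q (Finset.mem_univ q)
    hne (Or.inl hp) (Or.inr (by omega))
  omega

theorem LineStr.inner_edge (L : LineStr ω A col M) {x y : V} (hxy : col y = col x + 1)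
    (h0 : 0 < col x) (hM : col y < M) : A x y = 1 ∨ A x y = -1 := by
  refine L.unit_of_norm (Or.inl hxy) ?_
  by_contra hne
  rcases L.colStr.heavy x (Finset.mem_univ x) y (Finset.mem_univ y) (Or.inl hxy) hne with h | h
  · obtain ⟨q, hq⟩ := L.surj (col x - 1) (by omega) (by omega)
    have := (h.2 q (Finset.mem_univ q)).2 (Or.inr (by omega))
    omega
  · obtain ⟨q, hq⟩ := L.surj (col y + 1) (by omega) (by omega)
    have := (h.2 q (Finset.mem_univ q)).2 (Or.inl (by omega))
    omega

/-- The labels between columns `c` and `c + 1` of a line with given ends; those at the right end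
are read from right to left. -/
theorem LineStr.edge_cases (L : LineStr ω A col M) (hl : LeftEnd ω A col z α)
    (hr : LeftEnd ω A (fun x => M - col x) w β) {x y : V} (hxy : col y = col x + 1) :
    (col x = 0 ∧ (A x y = z ∨ A x y = -z)) ∨
    (col y = M ∧ (A x y = (starRingEnd ℂ) w ∨ A x y = -(starRingEnd ℂ) w)) ∨
    (0 < col x ∧ col y < M ∧ (A x y = 1 ∨ A x y = -1)) := by
  have h1 := L.range x
  have h2 := L.range y
  by_cases h3 : col x = 0
  · exact Or.inl ⟨h3, hl.edge x y h3 (by omega)⟩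
  by_cases h4 : col y = M
  · refine Or.inr (Or.inl ⟨h4, ?_⟩)
    rw [← L.herm.apply x y]
    rcases hr.edge y x (by omega) (by omega) with h5 | h5 <;> simp [h5]
  · exact Or.inr (Or.inr ⟨by omega, by omega, L.inner_edge hxy (by omega) (by omega)⟩)

theorem LineStr.diag_cases (L : LineStr ω A col M) (hl : LeftEnd ω A col z α)
    (hr : LeftEnd ω A (fun x => M - col x) w β) (x : V) :
    (col x = 0 ∧ A x x = α) ∨ (col x = M ∧ A x x = β) ∨
      (0 < col x ∧ col x < M ∧ A x x = 0) := by
  have h1 := L.range x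
  by_cases h3 : col x = 0
  · exact Or.inl ⟨h3, hl.diag x h3⟩
  by_cases h4 : col x = M
  · exact Or.inr (Or.inl ⟨h4, hr.diag x (by omega)⟩)
  · exact Or.inr (Or.inr ⟨by omega, by omega, L.inner_diag (by omega) (by omega)⟩)

theorem LineStr.omega_ne_one (L : LineStr ω A col M) : ω ≠ 1 ∧ (starRingEnd ℂ) ω ≠ 1 := by
  have h := L.norm
  constructor <;> intro h1
  · rw [h1] at h
    norm_num at h
  · rw [h1, mul_one] at h
    rw [h, map_ofNat] at h1
    norm_num at h1

/-- Two uncharged ends, either of which may have weight two. If an end has weight one, the ladder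
of `T_{2k}^4` is taken longer and the corresponding further vertex is not used. -/
theorem LineStr.equiv_graphT4 (L : LineStr ω A col M) (hl : LeftEnd ω A col z 0)
    (hr : LeftEnd ω A (fun x => M - col x) w 0) (hz : z = 1 ∨ z = (starRingEnd ℂ) ω) {η : ℂ}
    (hη : η ∈ edgeLabels ω) (hw : w = 1 ∨ (w ≠ 1 ∧ (η = (starRingEnd ℂ) w ∨
      η = -(starRingEnd ℂ) w))) :
    ∃ k, 2 ≤ k ∧ EquivToSubgraph A (graphT4Aux ω η k) := by
  have hM := L.three_le
  have hne := L.omega_ne_one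
  obtain ⟨row, hrow, hrow0⟩ := exists_row L.colStr
  obtain ⟨s, hs⟩ : ∃ s : ℤ, (s = 1 ∧ z = 1) ∨ (s = 0 ∧ z = (starRingEnd ℂ) ω ∧ z ≠ 1) := by
    rcases hz with h | h
    · exact ⟨1, Or.inl ⟨rfl, h⟩⟩
    · exact ⟨0, Or.inr ⟨rfl, h, h ▸ hne.2⟩⟩
  obtain ⟨e, he⟩ : ∃ e : ℤ, (e = 1 ∧ w = 1) ∨ (e = 0 ∧ w ≠ 1 ∧
      (η = (starRingEnd ℂ) w ∨ η = -(starRingEnd ℂ) w)) := by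
    rcases hw with h | h
    · exact ⟨1, Or.inl ⟨rfl, h⟩⟩
    · exact ⟨0, Or.inr ⟨rfl, h⟩⟩
  obtain ⟨k, hk⟩ : ∃ k : ℕ, (k : ℤ) = M + s + e :=
    ⟨(M + s + e).toNat, Int.toNat_of_nonneg (by omega)⟩
  refine ⟨k, by omega, equivToSubgraph_of_line (ω := ω) (col := fun x => col x + s) (row := row)
    (a := s) (b := M + s) L.ne_zero L.herm
    (L.colStr.of_iff subset_rfl (fun x _ y _ => by omega) (fun x _ y _ => by unfold Nb; omega))
    (by omega) (fun x => by have := L.range x; omega) (fun c h1 h2 => ?_)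
    (graphT4Aux_eq_model ω η (by omega)) (ladderLabels_graphT4 hη k) (fun _ => map_zero _)
    (fun _ => map_zero _) (fun x y hxy hc => hrow x y hxy (by omega)) (fun x => ?_)
    (fun x y hxy => ?_) fun x => ?_⟩
  · obtain ⟨x, hx⟩ := L.surj (c - s) (by omega) (by omega)
    exact ⟨x, by omega⟩
  · have hx := L.range x
    rw [mem_range_indexT4]
    dsimp only
    by_cases h1 : col x + s = 0
    · have hz1 : z ≠ 1 := by
        rcases hs with hs | hs
        · omega
        · exact hs.2.2
      refine Or.inr (Or.inl (Prod.ext h1 (hrow0 x fun y hy => ?_)))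
      exact (hl.single hz1).2 y x (by omega) (by omega)
    by_cases h2 : col x + s = k
    · have hw1 : w ≠ 1 := by
        rcases he with he | he
        · omega
        · exact he.2.1
      refine Or.inr (Or.inr (Prod.ext h2 (hrow0 x fun y hy => ?_)))
      exact (hr.single hw1).2 y x (by omega) (by omega)
    · exact Or.inl ⟨by omega, by omega⟩
  · have hxy' : col y = col x + 1 := by omega
    have hxr := L.range x
    have hyr := L.range y
    simp only [edgeT4]
    rcases L.edge_cases hl hr hxy' with ⟨h1, h2⟩ | ⟨h1, h2⟩ | ⟨h1, h2, h3⟩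
    · rcases hs with ⟨hs, hz1⟩ | ⟨hs, hz1, -⟩
      · rw [if_neg (by omega), if_neg (by omega), ← hz1]
        exact h2
      · rw [if_pos (by omega), ← hz1]
        exact h2
    · rcases he with ⟨he, hw1⟩ | ⟨he, -, hw1⟩
      · rw [if_neg (by omega), if_neg (by omega)]
        simpa [hw1] using h2
      · rw [if_neg (by omega), if_pos (by omega)]
        rcases h2 with h2 | h2 <;> rcases hw1 with hw1 | hw1 <;> simp [h2, hw1]
    · rwa [if_neg (by omega), if_neg (by omega)]
  · rcases L.diag_cases hl hr x with h | h | h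
    exacts [h.2, h.2, h.2.2]

/-- A charged left end and an uncharged right end, which may have weight two. -/
theorem LineStr.equiv_graphC2 {d : ℤ} (L : LineStr (omegaLabel d) A col M)
    (hl : LeftEnd (omegaLabel d) A col z 1)
    (hr : LeftEnd (omegaLabel d) A (fun x => M - col x) w 0)
    (hw : w = 1 ∨ w = (starRingEnd ℂ) (omegaLabel d)) :
    ∃ k, 1 ≤ k ∧ EquivToSubgraph A (graphC2 d k) := by
  have hM := L.three_le
  have hne := L.omega_ne_one
  obtain ⟨row, hrow, hrow0⟩ := exists_row L.colStr
  have hz1 : z = 1 := by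
    by_contra h
    exact one_ne_zero (hl.single h).1
  obtain ⟨e, he⟩ : ∃ e : ℤ, (e = 1 ∧ w = 1) ∨
      (e = 0 ∧ w = (starRingEnd ℂ) (omegaLabel d) ∧ w ≠ 1) := by
    rcases hw with h | h
    · exact ⟨1, Or.inl ⟨rfl, h⟩⟩
    · exact ⟨0, Or.inr ⟨rfl, h, h ▸ hne.2⟩⟩
  obtain ⟨k, hk⟩ : ∃ k : ℕ, (k : ℤ) = M + e :=
    ⟨(M + e).toNat, Int.toNat_of_nonneg (by omega)⟩
  have hk1 : 1 ≤ k := by omega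
  have conj01 : ∀ c : ℤ, (starRingEnd ℂ) (if c = 0 then (1 : ℂ) else 0) =
      if c = 0 then (1 : ℂ) else 0 := fun c => by split_ifs <;> simp
  refine ⟨k, hk1, equivToSubgraph_of_line (row := row) (a := 0) (b := M) L.ne_zero L.herm L.colStr
    (by omega) L.range L.surj (graphC2_eq_model d hk1) (ladderLabels_graphC2 hk1) conj01 conj01
    hrow (fun x => ?_) (fun x y hxy => ?_) fun x => ?_⟩
  · have hx := L.range x
    rw [mem_range_indexC2]
    by_cases h2 : col x = k
    · have hw1 : w ≠ 1 := by
        rcases he with he | he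
        · omega
        · exact he.2.2
      refine Or.inr (Prod.ext h2 (hrow0 x fun y hy => ?_))
      exact (hr.single hw1).2 y x (by omega) (by omega)
    · exact Or.inl ⟨hx.1, by dsimp only; omega⟩
  · have hyr := L.range y
    simp only [edgeC2]
    rcases L.edge_cases hl hr hxy with ⟨h1, h2⟩ | ⟨h1, h2⟩ | ⟨h1, h2, h3⟩
    · rw [if_neg (by omega), ← hz1]
      exact h2
    · rcases he with ⟨he, hw1⟩ | ⟨he, hw1, -⟩
      · rw [if_neg (by omega)]
        simpa [hw1] using h2
      · rw [if_pos (by omega)]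
        simpa [hw1] using h2
    · rwa [if_neg (by omega)]
  · rcases L.diag_cases hl hr x with h | h | h
    · rw [if_pos h.1, h.2]
    · rw [if_neg (by omega), h.2]
    · rw [if_neg (by omega), h.2.2]

/-- Two charged ends. -/
theorem LineStr.equiv_graphC (L : LineStr ω A col M) (hl : LeftEnd ω A col z 1) (ε : ℤˣ)
    (hr : LeftEnd ω A (fun x => M - col x) w ((ε : ℤ) : ℂ)) :
    ∃ k, 2 ≤ k ∧ EquivToSubgraph A (graphC ε k) := by
  have hM := L.three_le
  obtain ⟨row, hrow, -⟩ := exists_row L.colStr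
  have hz1 : z = 1 := by
    by_contra h
    exact one_ne_zero (hl.single h).1
  have hw1 : w = 1 := by
    by_contra h
    have := (hr.single h).1
    rcases Int.units_eq_one_or ε with rfl | rfl <;> simp at this
  obtain ⟨k, hk⟩ : ∃ k : ℕ, (k : ℤ) = M + 1 :=
    ⟨(M + 1).toNat, Int.toNat_of_nonneg (by omega)⟩
  refine ⟨k, by omega, equivToSubgraph_of_line (row := row) (a := 0) (b := M) L.ne_zero L.herm
    L.colStr (by omega) L.range L.surj (graphC_eq_model ε k) (ladderLabels_graphC ε k)
    (fun c => by unfold chargeC; split_ifs <;> simp)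
    (fun c => by unfold innerC; split_ifs <;> simp)
    hrow (fun x => ?_) (fun x y hxy => ?_) fun x => ?_⟩
  · have hx := L.range x
    rw [mem_range_ladder_index]
    exact ⟨hx.1, by dsimp only; omega⟩
  · rcases L.edge_cases hl hr hxy with ⟨h1, h2⟩ | ⟨h1, h2⟩ | ⟨h1, h2, h3⟩
    · rwa [hz1] at h2
    · simpa [hw1] using h2
    · exact h3
  · unfold chargeC
    rcases L.diag_cases hl hr x with h | h | h
    · rw [if_pos h.1, h.2]
    · rw [if_neg (by omega), if_pos (by omega), h.2]
    · rw [if_neg (by omega), if_neg (by omega), h.2.2]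

theorem conj_omegaLabel {d : ℤ} (hd : d = -2) :
    (starRingEnd ℂ) (omegaLabel d) = -omegaLabel d := by
  subst hd
  simp [omegaLabel, sqrtNeg]

theorem LineStr.inFamilies_of_uncharged {d : ℤ} (hd : d = -2 ∨ d = -7)
    (L : LineStr (omegaLabel d) A col M) (hl : LeftEnd (omegaLabel d) A col z 0)
    (hr : LeftEnd (omegaLabel d) A (fun x => M - col x) w 0)
    (hz : z = 1 ∨ z = (starRingEnd ℂ) (omegaLabel d)) : InFamilies d A := by
  have hne := L.omega_ne_one
  have main : (w = 1 ∨ (w ≠ 1 ∧ (omegaLabel d = (starRingEnd ℂ) w ∨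
      omegaLabel d = -(starRingEnd ℂ) w))) → InFamilies d A := fun hw =>
    Or.inr (Or.inr (Or.inl (L.equiv_graphT4 hl hr hz (by simp [edgeLabels]) hw)))
  rcases hr.label with hw | hw | hw
  · exact main (Or.inl hw)
  · rcases hd with hd | hd
    · refine main (Or.inr ⟨hw ▸ hne.1, Or.inr ?_⟩)
      rw [hw, conj_omegaLabel hd, neg_neg]
    · exact Or.inr (Or.inr (Or.inr (Or.inl ⟨hd, L.equiv_graphT4 hl hr hz (by simp [edgeLabels])
        (Or.inr ⟨hw ▸ hne.1, Or.inl (by rw [hw])⟩)⟩)))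
  · exact main (Or.inr ⟨hw ▸ hne.2, Or.inl (by rw [hw, Complex.conj_conj])⟩)

theorem LineStr.inFamilies_of_charged {d : ℤ}
    (L : LineStr (omegaLabel d) A col M) (hl : LeftEnd (omegaLabel d) A col z 1)
    (hr : LeftEnd (omegaLabel d) A (fun x => M - col x) w β) : InFamilies d A := by
  have charged : ∀ ε : ℤˣ, β = ((ε : ℤ) : ℂ) → InFamilies d A := fun ε hε => by
    obtain ⟨k, hk, h⟩ := L.equiv_graphC hl ε (hε ▸ hr)
    exact Or.inr (Or.inl ⟨k, hk, ε, h⟩)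
  rcases hr.charge with hβ | hβ | hβ
  · subst hβ
    rcases hr.label with hw | hw | hw
    · exact Or.inr (Or.inr (Or.inr (Or.inr (L.equiv_graphC2 hl hr (Or.inl hw)))))
    · refine InFamilies.of_imp (fun h => EquivToSubgraph.of_conj h)
        (Or.inr (Or.inr (Or.inr (Or.inr (L.conj.equiv_graphC2 hl.conj hr.conj (Or.inr ?_))))))
      rw [hw]
    · exact Or.inr (Or.inr (Or.inr (Or.inr (L.equiv_graphC2 hl hr (Or.inr hw)))))
  · exact charged 1 (by simp [hβ])
  · exact charged (-1) (by simp [hβ])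

/-- A graph whose columns form a line is in the families. Up to negation, conjugation and
reflection there are only three kinds of pairs of ends to consider. -/
theorem LineStr.inFamilies {d : ℤ} (hd : d = -2 ∨ d = -7)
    (L : LineStr (omegaLabel d) A col M) : InFamilies d A := by
  have charged : ∀ (col : V → ℤ) (z w α β : ℂ), LineStr (omegaLabel d) A col M →
      LeftEnd (omegaLabel d) A col z α → LeftEnd (omegaLabel d) A (fun x => M - col x) w β →
      α ≠ 0 → InFamilies d A := by
    intro col z w α β L hl hr hα
    rcases hl.charge with h | h | h
    · exact absurd h hα
    · exact L.inFamilies_of_charged (h ▸ hl) hr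
    · refine InFamilies.of_imp (fun h => EquivToSubgraph.of_neg h)
        (L.neg.inFamilies_of_charged (z := z) ?_ hr.neg)
      have := hl.neg
      rwa [h, neg_neg] at this
  obtain ⟨z, α, hl⟩ := L.exists_leftEnd
  obtain ⟨w, β, hr⟩ := L.reflect.exists_leftEnd
  by_cases hα : α = 0
  · by_cases hβ : β = 0
    · subst hα hβ
      rcases hl.label with hz | hz | hz
      · exact L.inFamilies_of_uncharged hd hl hr (Or.inl hz)
      · exact InFamilies.of_imp (fun h => EquivToSubgraph.of_conj h)
          (L.conj.inFamilies_of_uncharged hd hl.conj hr.conj (Or.inr (by rw [hz])))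
      · exact L.inFamilies_of_uncharged hd hl hr (Or.inr hz)
    · exact charged _ w z β α L.reflect hr (by simpa using hl) hβ
  · exact charged _ z w α β L hl hr hα

end Line

/-! ### Graphs all of whose proper connected subgraphs lie in the families -/

section Main

variable {V : Type*} [Fintype V] [DecidableEq V] {A : Matrix V V ℂ} {d : ℤ}

theorem omegaLabel_norm (hd : d = -2 ∨ d = -7) :
    omegaLabel d * (starRingEnd ℂ) (omegaLabel d) = 2 := by
  have h2 : ((Real.sqrt 2 : ℝ) : ℂ) * (Real.sqrt 2 : ℝ) = 2 := by
    rw [← Complex.ofReal_mul, Real.mul_self_sqrt (by norm_num)]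
    norm_num
  have h7 : ((Real.sqrt 7 : ℝ) : ℂ) * (Real.sqrt 7 : ℝ) = 7 := by
    rw [← Complex.ofReal_mul, Real.mul_self_sqrt (by norm_num)]
    norm_num
  rcases hd with rfl | rfl
  · simp [omegaLabel, sqrtNeg]
    linear_combination -Complex.I ^ 2 * h2 - 2 * Complex.I_sq
  · simp [omegaLabel, sqrtNeg, map_ofNat (starRingEnd ℂ) 2]
    linear_combination -(1 / 4) * Complex.I ^ 2 * h7 - (7 / 4) * Complex.I_sq

theorem LocallyColumnar.inFamilies (hd : d = -2 ∨ d = -7)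
    (G : LocallyColumnar (omegaLabel d) A) : InFamilies d A := by
  rcases G.exists_colStr with ⟨col, h⟩ | ⟨m, hm, col, hsurj, h⟩
  · obtain ⟨a, ha, hmin⟩ := Finset.exists_min_image _ col G.conn.1
    obtain ⟨b, hb, hmax⟩ := Finset.exists_max_image _ col G.conn.1
    have hcard := h.card_le (Finset.Icc (col a) (col b)) fun x hx =>
      Finset.mem_Icc.2 ⟨hmin x hx, hmax x hx⟩
    rw [Int.card_Icc, Finset.card_univ] at hcard
    have := G.card
    refine LineStr.inFamilies (M := col b - col a) (col := fun x => col x - col a) hd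
      ⟨omegaLabel_norm hd, G.herm, h.of_iff subset_rfl (fun x _ y _ => by omega)
        (fun x _ y _ => by unfold Nb; omega), by omega, fun x => ?_, fun c h0 h1 => ?_⟩
    · have h1 := hmin x (Finset.mem_univ x)
      have h2 := hmax x (Finset.mem_univ x)
      omega
    · obtain ⟨x, -, hx⟩ := h.exists_col_eq G.conn ha hb (c := c + col a) (by omega) (by omega)
      exact ⟨x, by omega⟩
  · exact Or.inl ⟨m, by omega, equivToSubgraph_graphT hm (omegaLabel_norm hd) G.herm hsurj h⟩

theorem inFamilies_of_properSubgraphs (hd : d = -2 ∨ d = -7) (hA : A.IsHermitian)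
    (hcard : 11 ≤ Fintype.card V) (hconn : (underlying A).Connected)
    (hsub : ProperSubgraphsInFamilies d A) : InFamilies d A := by
  refine LocallyColumnar.inFamilies hd ⟨hA, ?_, connOn_univ hA hconn, hcard, fun S hS hne h10 =>
    hasColStr_of_inFamilies (by omega)
      (hsub S (fun h => hne (Finset.coe_eq_univ.1 h)) (hS.connected hA))⟩
  intro h
  simpa [h] using omegaLabel_norm hd

omit [Fintype V] [DecidableEq V] in
/-- An edge of weight two excludes the families all of whose labels are `0`, `1` and `-1`. -/
theorem InFamilies.weightTwo (h : InFamilies d A) {i j : V}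
    (hij : A i j * (starRingEnd ℂ) (A i j) = 2) : InWeightTwoFamilies d A := by
  have key : ∀ {W : Type} {B : Matrix W W ℂ}, (∀ p q, B p q = 0 ∨ B p q = 1 ∨ B p q = -1) →
      ¬EquivToSubgraph A B := by
    intro W B hB hAB
    obtain ⟨f, σ, ε, θ, -, -, hA⟩ := equivToSubgraph_iff.1 hAB
    rw [hA i j] at hij
    rcases Int.units_eq_one_or (σ i) with h1 | h1 <;>
      rcases Int.units_eq_one_or (σ j) with h2 | h2 <;>
      rcases Int.units_eq_one_or ε with h3 | h3 <;>
      rcases hB (f i) (f j) with h4 | h4 | h4 <;> norm_num [h1, h2, h3, h4] at hij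
  rcases h with ⟨k, -, h⟩ | ⟨k, -, ε, h⟩ | h
  · refine absurd h (key fun p q => ?_)
    simp only [graphT, rowSign, Matrix.of_apply]
    split_ifs <;> simp
  · refine absurd h (key fun p q => ?_)
    simp only [graphC, ladderEdge, rowSign, Matrix.of_apply]
    rcases Int.units_eq_one_or ε with rfl | rfl <;> split_ifs <;> simp
  · exact h

end Main

theorem mainTheorem5 (d : ℤ) (hd : d = -2 ∨ d = -7) (n : ℕ) (hn : 11 ≤ n)
    (A : Matrix (Fin n) (Fin n) ℂ) (hconn : (underlying A).Connected)
    (hsub : ProperSubgraphsInFamilies d A) :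
    (IsLabelledGraph (labelSet' d) A → InFamilies d A) ∧
    (IsLabelledGraph (labelSet d) A → (∃ i j, i ≠ j ∧ A i j ∈ normSet d 2) →
      InWeightTwoFamilies d A) := by
  have main : A.IsHermitian → InFamilies d A := fun hA =>
    inFamilies_of_properSubgraphs hd hA (by simpa using hn) hconn hsub
  refine ⟨fun h => main h.1, fun h => ?_⟩
  rintro ⟨i, j, -, hij⟩
  exact (main h.1).weightTwo (by simpa using hij.2)
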